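/- Let $K$ be a commutative ring and let $\Lambda$ (resp. $\widehat\Lambda$) be the $K$-algebra of symmetric formal power series of bounded (resp. arbitrary) degree in $x_1,x_2,\dots$ with coefficients in $K$. Let $(\,,)\colon\widehat\Lambda\times\Lambda\to K$ be the Hall inner product, $\big(\sum_\lambda A_\lambda s_\lambda,\sum_\lambda B_\lambda s_\lambda\big)=\sum_\lambda A_\lambda B_\lambda$, where $s_\lambda$ are the Schur functions. For $t\in K$ let $E(t)=\sum_{i\ge 0}t^i e_i\in\widehat\Lambda$, where $e_i$ are the elementary symmetric functions. For a skew shape $\lambda/\mu$ (partitions $\mu\subset\lambda$), the dual stable Grothendieck polynomial is $g_{\lambda/\mu}=\sum_T\prod_i x_i^{T(i)}$, summed over the fillings $T$ of the boxes of $\lambda/\mu$ with positive integers that increase weakly along every row and every column, where $T(i)$ is the number of columns of $T$ that contain $i$; write $g_\lambda=g_{\lambda/\emptyset}$. Let $|\lambda/\mu|$ be the number of boxes of $\lambda/\mu$ and $c(\lambda/\mu)$ the number of columns containing at least one box of $\lambda/\mu$; $\lambda/\mu$ is a vertical strip if it has at most one box in each row. Then $g_{\lambda/\mu}\in\Lambda$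 for every skew shape $\lambda/\mu$, and for every $t\in K$ the map $(E(t),-)\colon\Lambda\to K$ is a $K$-algebra homomorphism which satisfies, for every skew shape $\lambda/\mu$, $$(E(t),g_{\lambda/\mu})=\begin{cases}t^{c(\lambda/\mu)}(t+1)^{|\lambda/\mu|-c(\lambda/\mu)}&\text{if }\lambda/\mu\text{ is a vertical strip},\\0&\text{otherwise.}\end{cases}$$ In particular, for every partition $\lambda$, $$(E(t),g_\lambda)=\begin{cases}1&\text{if }\lambda=\emptyset,\\t(t+1)^{n-1}&\text{if }\lambda=(1^n)\ (n\ge1),\\0&\text{otherwise.}\end{cases}$$ -/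

import Mathlib

namespace DualGrothendieck

/-! ### Symmetric functions

The variables `x₁, x₂, …` are indexed by `ℕ`, so that `x_{k+1}` is the variable with index `k`. -/

/-- The completed ring of symmetric functions: all symmetric formal power series in countably many
variables, of possibly unbounded degree. -/
noncomputable def SymSeries (K : Type*) [CommRing K] : Subalgebra K (MvPowerSeries ℕ K) where
  carrier := {F | ∀ σ : Equiv.Perm ℕ, MvPowerSeries.renameEquiv K σ F = F}
  mul_mem' := by
    intro a b ha hb σ
    rw [map_mul, ha σ, hb σ]
  add_mem' := by
    intro a b ha hb σ
    rw [map_add, ha σ, hb σ]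
  algebraMap_mem' := by
    intro r σ
    exact AlgEquiv.commutes _ r

/-- The ring of symmetric functions: symmetric formal power series of bounded degree. -/
noncomputable def SymFun (K : Type*) [CommRing K] : Subalgebra K (MvPowerSeries ℕ K) where
  carrier := {F | F ∈ SymSeries K ∧
    ∃ N : ℕ, ∀ d : ℕ →₀ ℕ, N < d.degree → MvPowerSeries.coeff d F = 0}
  mul_mem' := by
    classical
    rintro a b ⟨ha, N, hN⟩ ⟨hb, M, hM⟩
    refine ⟨mul_mem ha hb, N + M, fun d hd => ?_⟩
    rw [MvPowerSeries.coeff_mul]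
    refine Finset.sum_eq_zero fun p hp => ?_
    rw [Finset.HasAntidiagonal.mem_antidiagonal] at hp
    have hdeg : p.1.degree + p.2.degree = d.degree := by rw [← hp, map_add]
    by_cases h : N < p.1.degree
    · rw [hN _ h, zero_mul]
    · rw [hM _ (by omega), mul_zero]
  add_mem' := by
    rintro a b ⟨ha, N, hN⟩ ⟨hb, M, hM⟩
    refine ⟨add_mem ha hb, N + M, fun d hd => ?_⟩
    rw [map_add, hN _ (by omega), hM _ (by omega), add_zero]
  algebraMap_mem' := by
    classical
    intro r
    refine ⟨Subalgebra.algebraMap_mem _ r, 0, fun d hd => ?_⟩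
    have hd0 : d ≠ 0 := by
      rintro rfl
      simp at hd
    rw [← MvPowerSeries.c_eq_algebraMap, MvPowerSeries.coeff_C, if_neg hd0]

/-- The Schur function of a Young diagram: the generating function of semistandard tableaux. The
coefficient of `x ^ d` is the number of tableaux in which each `k` occurs exactly `d k` times. -/
noncomputable def schur (K : Type*) [CommRing K] (lam : YoungDiagram) : MvPowerSeries ℕ K :=
  fun d => (Nat.card {T : SemistandardYoungTableau lam //
    ∀ k, (lam.cells.filter fun c => T c.1 c.2 = k).card = d k} : K)

/-- `F = ∑ A_lam s_lam`, a possibly infinite linear combination, taken coefficientwise (for a given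
monomial only finitely many Schur functions contribute, as they are homogeneous). -/
def IsSchurExpansion {K : Type*} [CommRing K] (F : MvPowerSeries ℕ K) (A : YoungDiagram → K) :
    Prop :=
  ∀ d : ℕ →₀ ℕ, MvPowerSeries.coeff d F =
    ∑ᶠ lam : YoungDiagram, A lam * MvPowerSeries.coeff d (schur K lam)

open Classical in
/-- The coefficients of a symmetric series in its (unique) expansion into Schur functions. -/
noncomputable def schurCoeff {K : Type*} [CommRing K] (F : MvPowerSeries ℕ K) :
    YoungDiagram → K :=
  if h : ∃ A, IsSchurExpansion F A then h.choose else 0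

/-- The Hall inner product, extended to symmetric series in its first argument: the form for which
the Schur functions are orthonormal, `(∑ A_lam s_lam, ∑ B_lam s_lam) = ∑ A_lam B_lam`. The sum is
finite because the second argument has bounded degree. -/
noncomputable def hall {K : Type*} [CommRing K] (F : SymSeries K) (f : SymFun K) : K :=
  ∑ᶠ lam : YoungDiagram,
    schurCoeff (F : MvPowerSeries ℕ K) lam * schurCoeff (f : MvPowerSeries ℕ K) lam

/-- The elementary symmetric function `e_i`: the sum of all squarefree monomials of degree `i`. -/
noncomputable def elem (K : Type*) [CommRing K] (i : ℕ) : MvPowerSeries ℕ K :=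
  open Classical in fun d => if (∀ k, d k ≤ 1) ∧ d.degree = i then 1 else 0

/-- The series `∑ i, t ^ i * e_i`, the sum being taken coefficientwise. -/
noncomputable def elemGen {K : Type*} [CommRing K] (t : K) : MvPowerSeries ℕ K :=
  fun d => ∑ᶠ i : ℕ, t ^ i * MvPowerSeries.coeff d (elem K i)

theorem elemGen_mem {K : Type*} [CommRing K] (t : K) : elemGen t ∈ SymSeries K := by
  classical
  have key : ∀ (σ : Equiv.Perm ℕ) (d : ℕ →₀ ℕ) (i : ℕ),
      MvPowerSeries.coeff (Finsupp.embDomain σ.toEmbedding d) (elem K i) =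
        MvPowerSeries.coeff d (elem K i) := by
    intro σ d i
    have h1 : (∀ k, Finsupp.embDomain σ.toEmbedding d k ≤ 1) ↔ ∀ k, d k ≤ 1 := by
      constructor
      · intro h k
        have := h (σ.toEmbedding k)
        rwa [Finsupp.embDomain_apply_self] at this
      · intro h k
        obtain ⟨m, rfl⟩ := σ.surjective k
        have := Finsupp.embDomain_apply_self σ.toEmbedding d m
        rw [Equiv.coe_toEmbedding] at this
        rw [this]
        exact h m
    have h2 : (Finsupp.embDomain σ.toEmbedding d).degree = d.degree := by
      rw [Finsupp.degree_apply, Finsupp.degree_apply, Finsupp.support_embDomain, Finset.sum_map]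
      exact Finset.sum_congr rfl fun x _ => Finsupp.embDomain_apply_self _ _ _
    change (if (∀ k, Finsupp.embDomain σ.toEmbedding d k ≤ 1) ∧
      (Finsupp.embDomain σ.toEmbedding d).degree = i then (1 : K) else 0) =
        if (∀ k, d k ≤ 1) ∧ d.degree = i then 1 else 0
    rw [h1, h2]
  intro σ
  ext x
  obtain ⟨d, rfl⟩ : ∃ d, Finsupp.embDomain σ.toEmbedding d = x :=
    ⟨Finsupp.embDomain σ.symm.toEmbedding x, by
      ext k
      obtain ⟨m, rfl⟩ := σ.surjective k
      have h1 := Finsupp.embDomain_apply_self σ.toEmbedding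
        (Finsupp.embDomain σ.symm.toEmbedding x) m
      have h2 := Finsupp.embDomain_apply_self σ.symm.toEmbedding x (σ m)
      simp only [Equiv.coe_toEmbedding, Equiv.symm_apply_apply] at h1 h2
      rw [h1, h2]⟩
  have h := MvPowerSeries.coeff_embDomain_rename σ.toEmbedding (elemGen t) d
  have h' : MvPowerSeries.coeff (Finsupp.embDomain σ.toEmbedding d) (elemGen t) =
      MvPowerSeries.coeff d (elemGen t) := by
    change ∑ᶠ i : ℕ, _ = ∑ᶠ i : ℕ, _
    simp only [key]
  rw [h']
  exact h

/-- `E(t) = ∑ i, t ^ i * e_i` as an element of the completed ring of symmetric functions. -/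
noncomputable def E {K : Type*} [CommRing K] (t : K) : SymSeries K := ⟨elemGen t, elemGen_mem t⟩

/-! ### Skew shapes and dual stable Grothendieck polynomials

A skew shape `lam / μ` is given by Young diagrams `μ ≤ lam`. A cell `(i, j)` lies in row `i` and
column `j`. -/

/-- The boxes of the skew shape `lam / μ`. -/
def skewCells (lam μ : YoungDiagram) : Finset (ℕ × ℕ) := lam.cells \ μ.cells

/-- `c(lam / μ)`: the number of columns that contain a box of `lam / μ`. -/
def numCols (lam μ : YoungDiagram) : ℕ := ((skewCells lam μ).image Prod.snd).card

/-- `lam / μ` is a vertical strip: no row contains two of its boxes. -/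
def IsVerticalStrip (lam μ : YoungDiagram) : Prop :=
  ∀ a ∈ skewCells lam μ, ∀ b ∈ skewCells lam μ, a.1 = b.1 → a = b

instance (lam μ : YoungDiagram) : Decidable (IsVerticalStrip lam μ) :=
  inferInstanceAs (Decidable (∀ a ∈ skewCells lam μ, ∀ b ∈ skewCells lam μ, a.1 = b.1 → a = b))

/-- A reverse plane partition of shape `lam / μ`: a filling of the boxes, weakly increasing along
rows and columns. An entry `k` stands for the positive integer `k + 1`; outside the shape the
function vanishes by convention. -/
@[ext]
structure ReversePlanePartition (lam μ : YoungDiagram) where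
  entry : ℕ → ℕ → ℕ
  row_weak : ∀ {i j₁ j₂ : ℕ}, j₁ < j₂ → (i, j₁) ∈ skewCells lam μ → (i, j₂) ∈ skewCells lam μ →
    entry i j₁ ≤ entry i j₂
  col_weak : ∀ {i₁ i₂ j : ℕ}, i₁ < i₂ → (i₁, j) ∈ skewCells lam μ → (i₂, j) ∈ skewCells lam μ →
    entry i₁ j ≤ entry i₂ j
  zeros : ∀ {i j : ℕ}, (i, j) ∉ skewCells lam μ → entry i j = 0

/-- The number of columns of `T` that contain the entry `k`. -/
def ReversePlanePartition.colCount {lam μ : YoungDiagram} (T : ReversePlanePartition lam μ)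
    (k : ℕ) : ℕ :=
  (((skewCells lam μ).filter fun c => T.entry c.1 c.2 = k).image Prod.snd).card

/-- The dual stable Grothendieck polynomial `g_{lam / μ}`, the sum over reverse plane partitions `T`
of the monomials in which the variable with index `k` has as exponent the number of columns of `T`
containing `k`. -/
noncomputable def dualGroth (K : Type*) [CommRing K] (lam μ : YoungDiagram) : MvPowerSeries ℕ K :=
  fun d => (Nat.card {T : ReversePlanePartition lam μ // ∀ k, T.colCount k = d k} : K)

/-- The one-column partition `(1 ^ n)`. -/
def oneColumn (n : ℕ) : YoungDiagram where
  cells := Finset.range n ×ˢ {0}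
  isLowerSet := by
    rintro ⟨a, b⟩ ⟨c, d⟩ h hab
    simp only [Prod.mk_le_mk] at h
    simp only [Finset.coe_product, Finset.coe_range, Finset.coe_singleton, Set.mem_prod,
      Set.mem_Iio, Set.mem_singleton_iff] at hab ⊢
    omega

end DualGrothendieck

/-! Pairing with ∏ᵢ (1 - a xᵢ)⁻ⁿ evaluates a symmetric function at n variables equal to a. Since
E(t) = ∏ᵢ (1 + t xᵢ), pairing with E(t) should be evaluation at "n = -1 variables equal to -t". This
becomes rigorous as follows. For f symmetric of bounded degree, the value of f at n variables equal
to -t is a sequence in n killed by an iterate of the difference operator. Such a sequence has at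
most one extension to n = -1 of the same kind (`polySeq_ext`), over any commutative ring. Extendable
sequences form an algebra and evaluation is multiplicative, so once the value at n = -1 is
identified with the Hall pairing (`exists_hasValues`), the pairing is an algebra homomorphism.

The values come from transfer operators in the incidence algebra of Young's lattice. A filling is
the chain of diagrams cut out by its entries less than k. Hence s_λ and g_{λ/μ} at n variables equal
to -t are entries of the n-th powers of the unipotent operators `horizOp (-t)` and `colOp (-t)`.
Powers of a unipotent operator have entrywise vanishing iterated differences, and their extension to
n = -1 is the inverse. Row ∅ of the inverse of `horizOp (-t)` lists the Schur coefficients of E(t)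
(`elemOp_mul_horizOp`, `schurCoeff_elemGen`), which gives the Hall pairing. The inverse of `colOp
(-t)` is `vertOp t` (`vertOp_mul_colOp`), whose entries are the asserted values.

Symmetry of s_λ and g_{λ/μ} is commutation of the operators for different variables. Horizontal and
vertical strip operators commute because the entries of a product factor over rows or columns into
convolutions (`stripOp_commute`); `colOp` inherits commutation from its inverse. Schur expansions
exist and are unique because the Kostka matrices are unitriangular. -/

namespace DualGrothendieck

open Finset

/-! ### Sequences with vanishing iterated differences -/

theorem fwdDiff_iter_zero {K : Type*} [CommRing K] (D : ℕ) :
    (fwdDiff 1)^[D] (0 : ℕ → K) = 0 := by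
  induction D with
  | zero => rfl
  | succ D ih =>
    rw [Function.iterate_succ_apply]
    have : fwdDiff 1 (0 : ℕ → K) = 0 := by funext n; simp [fwdDiff]
    rw [this, ih]

theorem fwdDiff_iter_eq_zero_of_le {K : Type*} [CommRing K] {f : ℕ → K} {D D' : ℕ} (h : D ≤ D')
    (hf : (fwdDiff 1)^[D] f = 0) : (fwdDiff 1)^[D'] f = 0 := by
  obtain ⟨k, rfl⟩ := Nat.exists_eq_add_of_le' h
  rw [Function.iterate_add_apply, hf, fwdDiff_iter_zero]

/-- By the discrete Leibniz rule Δ(fg) = Δf·g + f·Δg + Δf·Δg, every term has a smaller total order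
of vanishing, so induction on A + B applies. -/
theorem fwdDiff_iter_mul_eq_zero {K : Type*} [CommRing K] (s : ℕ) :
    ∀ (A B : ℕ) (f g : ℕ → K), A + B = s → (fwdDiff 1)^[A] f = 0 → (fwdDiff 1)^[B] g = 0 →
      (fwdDiff 1)^[s] (f * g) = 0 := by
  induction s with
  | zero =>
    intro A B f g hs hf hg
    obtain rfl : A = 0 := by omega
    simp only [Function.iterate_zero, id_eq] at hf ⊢
    simp [hf]
  | succ s ih =>
    intro A B f g hs hf hg
    rcases A with _ | A
    · simp only [Function.iterate_zero, id_eq] at hf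
      rw [hf, zero_mul, fwdDiff_iter_zero]
    rcases B with _ | B
    · simp only [Function.iterate_zero, id_eq] at hg
      rw [hg, mul_zero, fwdDiff_iter_zero]
    have key : fwdDiff 1 (f * g) = fwdDiff 1 f * g +
        (f * fwdDiff 1 g + fwdDiff 1 f * fwdDiff 1 g) := by
      rw [← add_assoc]
      simpa using fwdDiff_smul 1 f g
    rw [Function.iterate_succ_apply, key, fwdDiff_iter_add, fwdDiff_iter_add,
      ih A (B + 1) _ _ (by omega) hf hg, ih (A + 1) B _ _ (by omega) hf hg, zero_add, zero_add]
    -- The term Δf·Δg has total order s - 1; the order of Δg is weakened from B to B + 1 to meet s.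
    exact ih A (B + 1) _ _ (by omega) hf (fwdDiff_iter_eq_zero_of_le (Nat.le_succ B) hg)

/-- The algebra of sequences that are annihilated by some iterate of the difference operator. -/
def polySeq (K : Type*) [CommRing K] : Subalgebra K (ℕ → K) where
  carrier := {f | ∃ D, (fwdDiff 1)^[D] f = 0}
  mul_mem' := by
    rintro f g ⟨A, hA⟩ ⟨B, hB⟩
    exact ⟨A + B, fwdDiff_iter_mul_eq_zero _ A B f g rfl hA hB⟩
  add_mem' := by
    rintro f g ⟨A, hA⟩ ⟨B, hB⟩
    refine ⟨max A B, ?_⟩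
    rw [fwdDiff_iter_add, fwdDiff_iter_eq_zero_of_le (le_max_left A B) hA,
      fwdDiff_iter_eq_zero_of_le (le_max_right A B) hB, add_zero]
  algebraMap_mem' := by
    intro r
    refine ⟨1, ?_⟩
    funext n
    simp [fwdDiff]

/-- The difference Δf also vanishes at all positive arguments, so by induction Δf = 0 and f 0 = f 1
= 0. No division occurs, so torsion in K is harmless. -/
theorem eq_zero_of_fwdDiff_iter_eq_zero {K : Type*} [CommRing K] (D : ℕ) :
    ∀ f : ℕ → K, (fwdDiff 1)^[D] f = 0 → (∀ n, f (n + 1) = 0) → f = 0 := by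
  induction D with
  | zero => intro f hf _; exact hf
  | succ D ih =>
    intro f hf h
    have h1 := ih (fwdDiff 1 f) hf (fun n => by simp [fwdDiff, h])
    funext n
    rcases n with _ | n
    · have := congrFun h1 0
      simpa [fwdDiff, h] using this
    · exact h n

theorem polySeq_ext {K : Type*} [CommRing K] {f g : ℕ → K} (hf : f ∈ polySeq K)
    (hg : g ∈ polySeq K) (h : ∀ n, f (n + 1) = g (n + 1)) : f = g := by
  obtain ⟨D, hD⟩ := sub_mem hf hg
  exact sub_eq_zero.1 (eq_zero_of_fwdDiff_iter_eq_zero D _ hD fun n => by simp [h])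

/-! ### Incidence algebra of Young's lattice -/

section YoungLattice

noncomputable instance : DecidableEq YoungDiagram := Classical.decEq _

theorem finite_Iic_youngDiagram (lam : YoungDiagram) : (Set.Iic lam).Finite := by
  refine Set.Finite.of_finite_image (f := YoungDiagram.cells)
    ((lam.cells.powerset : Finset _).finite_toSet.subset ?_) (fun a _ b _ h => YoungDiagram.ext h)
  rintro _ ⟨ν, hν, rfl⟩
  simpa using YoungDiagram.cells_subset_iff.2 hν

noncomputable instance : LocallyFiniteOrder YoungDiagram :=
  LocallyFiniteOrder.ofFiniteIcc fun _ lam =>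
    (finite_Iic_youngDiagram lam).subset Set.Icc_subset_Iic_self

theorem card_lt_card_of_lt {μ lam : YoungDiagram} (h : μ < lam) : μ.card < lam.card :=
  Finset.card_lt_card (YoungDiagram.cells_ssubset_iff.2 h)

/-- The incidence algebra of Young's lattice. -/
abbrev IA (R : Type*) [CommRing R] := IncidenceAlgebra R YoungDiagram

variable {R S : Type*} [CommRing R] [CommRing S]

/-- The ring homomorphism of incidence algebras induced by a ring homomorphism. -/
def iaMap (φ : R →+* S) : IA R →+* IA S where
  toFun f := ⟨fun a b => φ (f a b), fun a b h => by
    rw [IncidenceAlgebra.apply_eq_zero_of_not_le h, map_zero]⟩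
  map_one' := by
    ext a b _
    simp only [IncidenceAlgebra.coe_mk, IncidenceAlgebra.one_apply]
    split_ifs <;> simp
  map_mul' f g := by
    ext a b _
    simp [IncidenceAlgebra.mul_apply]
  map_zero' := by
    ext a b _
    simp [IncidenceAlgebra.zero_apply]
  map_add' f g := by
    ext a b _
    simp [IncidenceAlgebra.add_apply]

@[simp] theorem iaMap_apply (φ : R →+* S) (f : IA R) (a b : YoungDiagram) :
    iaMap φ f a b = φ (f a b) := rfl

theorem ia_mul_self (f g : IA R) (a : YoungDiagram) : (f * g) a a = f a a * g a a := by
  simp [IncidenceAlgebra.mul_apply]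

/-- Triangularity: by induction on the size of the interval, all terms of (f * Y) a b but f a a * Y
a b vanish. -/
theorem ia_eq_zero_of_mul_eq_zero {f Y : IA R} (hf : ∀ a, IsUnit (f a a)) (h : f * Y = 0) :
    Y = 0 := by
  have key : ∀ n (a b : YoungDiagram), a ≤ b → b.card - a.card = n → Y a b = 0 := by
    intro n
    induction n using Nat.strong_induction_on with
    | _ n ih =>
      intro a b hab hn
      have h1 : (f * Y) a b = 0 := by rw [h]; rfl
      rw [IncidenceAlgebra.mul_apply, Finset.sum_eq_single_of_mem a (by simp [hab])] at h1
      · exact (hf a).mul_right_eq_zero.1 h1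
      · intro x hx hxa
        rw [Finset.mem_Icc] at hx
        have hlt := card_lt_card_of_lt (lt_of_le_of_ne hx.1 (Ne.symm hxa))
        have := Finset.card_le_card (YoungDiagram.cells_subset_iff.2 hx.2)
        rw [ih (b.card - x.card) (by simp only [YoungDiagram.card] at *; omega) x b hx.2 rfl,
          mul_zero]
  ext a b hab
  exact key _ a b hab rfl

/-- Each factor of X, having zero diagonal, adds at least one box. -/
theorem ia_pow_apply_eq_zero {X : IA R} (hX : ∀ a, X a a = 0) (n : ℕ) :
    ∀ a b : YoungDiagram, b.card < a.card + n → (X ^ n) a b = 0 := by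
  induction n with
  | zero =>
    intro a b h
    rw [pow_zero, IncidenceAlgebra.one_apply, if_neg]
    rintro rfl
    simp at h
  | succ n ih =>
    intro a b h
    rw [pow_succ', IncidenceAlgebra.mul_apply]
    refine Finset.sum_eq_zero fun x hx => ?_
    rw [Finset.mem_Icc] at hx
    by_cases hxa : a = x
    · rw [← hxa, hX, zero_mul]
    · have hlt := card_lt_card_of_lt (lt_of_le_of_ne hx.1 hxa)
      rw [ih x b (by simp only [YoungDiagram.card] at *; omega), mul_zero]

/-- Powers of a unipotent element of the incidence algebra depend polynomially on the exponent. -/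
theorem ia_mul_pow_mem_polySeq {Z : IA R} (hZ : ∀ a, Z a a = 1) (W : IA R) (a b : YoungDiagram) :
    (fun n => (W * Z ^ n) a b) ∈ polySeq R := by
  have key : ∀ D (W : IA R), (fwdDiff 1)^[D] (fun n => (W * Z ^ n) a b) =
      fun n => (W * (Z ^ n * (Z - 1) ^ D)) a b := by
    intro D
    induction D with
    | zero => intro W; simp
    | succ D ih =>
      intro W
      rw [Function.iterate_succ_apply', ih]
      funext n
      rw [fwdDiff, ← IncidenceAlgebra.sub_apply, ← mul_sub, pow_succ Z n, mul_assoc (Z ^ n),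
        ← mul_sub, pow_succ', sub_mul, one_mul]
  -- The D-th difference is W Zⁿ (Z - 1)^D with Z - 1 strictly triangular; the exponent b.card + 1
  -- exceeds the number of boxes between any x and b.
  refine ⟨b.card + 1, ?_⟩
  rw [key]
  funext n
  rw [← mul_assoc, IncidenceAlgebra.mul_apply]
  refine Finset.sum_eq_zero fun x _ => ?_
  rw [ia_pow_apply_eq_zero (fun a => by simp [IncidenceAlgebra.sub_apply, hZ]) _ _ _ (by omega),
    mul_zero]

end YoungLattice

/-! ### Row and column lengths -/

section Lengths

theorem le_iff_rowLen {μ lam : YoungDiagram} : μ ≤ lam ↔ ∀ i, μ.rowLen i ≤ lam.rowLen i := by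
  constructor
  · intro h i
    by_contra! hc
    exact lt_irrefl _ (YoungDiagram.mem_iff_lt_rowLen.1 (h (YoungDiagram.mem_iff_lt_rowLen.2 hc)))
  · rintro h ⟨i, j⟩ hc
    exact YoungDiagram.mem_iff_lt_rowLen.2 ((YoungDiagram.mem_iff_lt_rowLen.1 hc).trans_le (h i))

theorem le_iff_colLen {μ lam : YoungDiagram} : μ ≤ lam ↔ ∀ i, μ.colLen i ≤ lam.colLen i := by
  rw [← YoungDiagram.transpose_le_iff, le_iff_rowLen]
  simp only [YoungDiagram.rowLen_transpose]

theorem rowLen_eq_zero {lam : YoungDiagram} {i : ℕ} (h : lam.card ≤ i) : lam.rowLen i = 0 := by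
  by_contra hc
  have hsub : (range (i + 1)).image (fun k => (k, 0)) ⊆ lam.cells := by
    intro c hc'
    obtain ⟨k, hk, rfl⟩ := Finset.mem_image.1 hc'
    exact lam.up_left_mem (Nat.lt_succ_iff.1 (Finset.mem_range.1 hk)) le_rfl
      (YoungDiagram.mem_iff_lt_rowLen.2 (Nat.pos_of_ne_zero hc))
  have := Finset.card_le_card hsub
  rw [Finset.card_image_of_injective _ (fun a b h => (Prod.mk.inj h).1), Finset.card_range] at this
  simp only [YoungDiagram.card] at h
  omega

theorem card_transpose (lam : YoungDiagram) : lam.transpose.card = lam.card := by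
  simp [YoungDiagram.transpose, YoungDiagram.card]

theorem colLen_eq_zero {lam : YoungDiagram} {i : ℕ} (h : lam.card ≤ i) : lam.colLen i = 0 := by
  rw [← YoungDiagram.rowLen_transpose]
  exact rowLen_eq_zero (by rwa [card_transpose])

/-- The Young diagram with prescribed row lengths. -/
def ofRows (g : ℕ → ℕ) (hg : Antitone g) (N : ℕ) : YoungDiagram where
  cells := (range N ×ˢ range (g 0)).filter fun c => c.2 < g c.1
  isLowerSet := by
    rintro ⟨a, b⟩ ⟨c, d⟩ h hab
    simp only [Prod.mk_le_mk] at h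
    simp only [coe_filter, Finset.mem_product, Finset.mem_range, Set.mem_ofPred_eq] at hab ⊢
    have := hg h.1
    omega

theorem rowLen_ofRows {g : ℕ → ℕ} (hg : Antitone g) {N : ℕ} (hN : ∀ i, N ≤ i → g i = 0) (i : ℕ) :
    (ofRows g hg N).rowLen i = g i := by
  have key : ∀ j, j < (ofRows g hg N).rowLen i ↔ j < g i := by
    intro j
    rw [← YoungDiagram.mem_iff_lt_rowLen, ← YoungDiagram.mem_cells]
    simp only [ofRows, mem_filter, Finset.mem_product, Finset.mem_range, and_iff_right_iff_imp]
    intro h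
    refine ⟨?_, h.trans_le (hg (Nat.zero_le i))⟩
    by_contra hc
    rw [hN i (by omega)] at h
    omega
  have h1 := key (g i)
  have h2 := key ((ofRows g hg N).rowLen i)
  omega

/-- The properties shared by row lengths and column lengths. -/
structure IsLength (len : YoungDiagram → ℕ → ℕ) : Prop where
  le_iff : ∀ {μ lam : YoungDiagram}, μ ≤ lam ↔ ∀ i, len μ i ≤ len lam i
  eq_zero : ∀ {lam : YoungDiagram} {i : ℕ}, lam.card ≤ i → len lam i = 0
  surj : ∀ {g : ℕ → ℕ} {N : ℕ}, Antitone g → (∀ i, N ≤ i → g i = 0) → ∃ ν, ∀ i, len ν i = g i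

theorem IsLength.ext {len : YoungDiagram → ℕ → ℕ} (hlen : IsLength len) {μ lam : YoungDiagram}
    (h : ∀ i, len μ i = len lam i) : μ = lam :=
  le_antisymm (hlen.le_iff.2 fun i => (h i).le) (hlen.le_iff.2 fun i => (h i).ge)

theorem isLength_rowLen : IsLength YoungDiagram.rowLen :=
  ⟨le_iff_rowLen, rowLen_eq_zero, fun hg hN => ⟨ofRows _ hg _, rowLen_ofRows hg hN⟩⟩

theorem isLength_colLen : IsLength YoungDiagram.colLen :=
  ⟨le_iff_colLen, colLen_eq_zero, fun hg hN => ⟨(ofRows _ hg _).transpose, fun i => by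
    rw [YoungDiagram.colLen_transpose, rowLen_ofRows hg hN]⟩⟩

variable {R : Type*} [CommRing R]

/-- Summation over Young diagrams whose lengths vary in independent intervals. -/
theorem IsLength.sum_prod {len : YoungDiagram → ℕ → ℕ} (hlen : IsLength len)
    (S : Finset YoungDiagram) (N : ℕ) (l u : ℕ → ℕ) (f : ℕ → ℕ → R)
    (hul : ∀ i, u (i + 1) ≤ l i) (hu : ∀ i, N ≤ i → u i = 0) (hl : ∀ i, N ≤ i → l i = 0)
    (hS : ∀ ν : YoungDiagram, ν ∈ S ↔ ∀ i, l i ≤ len ν i ∧ len ν i ≤ u i) :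
    ∑ ν ∈ S, ∏ i ∈ range N, f i (len ν i) =
      ∏ i ∈ range N, ∑ n ∈ Icc (l i) (u i), f i n := by
  rw [← Fin.prod_univ_eq_prod_range (fun i => ∑ n ∈ Icc (l i) (u i), f i n), Finset.prod_univ_sum]
  refine Finset.sum_bij (fun ν _ => fun i : Fin N => len ν i) ?_ ?_ ?_ ?_
  · intro ν hν
    rw [Fintype.mem_piFinset]
    intro i
    exact Finset.mem_Icc.2 ((hS ν).1 hν i)
  · intro ν hν ν' hν' h
    refine hlen.ext fun i => ?_
    by_cases hi : i < N
    · exact congrFun h ⟨i, hi⟩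
    · have h1 := ((hS ν).1 hν i).2
      have h2 := ((hS ν').1 hν' i).2
      rw [hu i (by omega)] at h1 h2
      omega
  · intro p hp
    rw [Fintype.mem_piFinset] at hp
    let g : ℕ → ℕ := fun i => if h : i < N then p ⟨i, h⟩ else 0
    have hgb : ∀ i, l i ≤ g i ∧ g i ≤ u i := by
      intro i
      by_cases h : i < N
      · simpa [g, h] using hp ⟨i, h⟩
      · simp [g, h, hl i (by omega)]
    -- The next upper bound is at most the present lower bound, so arbitrary independent choices in
    -- the intervals are weakly decreasing.
    have hg : Antitone g := antitone_nat_of_succ_le fun i =>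
      ((hgb (i + 1)).2.trans (hul i)).trans (hgb i).1
    obtain ⟨ν, hν⟩ := hlen.surj hg (N := N) fun i hi => dif_neg (by omega)
    refine ⟨ν, (hS _).2 fun i => by rw [hν]; exact hgb i, ?_⟩
    funext i
    rw [hν]
    exact dif_pos i.2
  · intro ν _
    exact (Fin.prod_univ_eq_prod_range (fun i => f i (len ν i)) N).symm

end Lengths

/-! ### Commutation of strip operators -/

section Interlacing

variable {R : Type*} [CommRing R]

/-- The convolution of two sequences. -/
def conv (a b : ℕ → R) (L : ℕ) : R := ∑ m ∈ range (L + 1), a m * b (L - m)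

theorem conv_comm (a b : ℕ → R) (L : ℕ) : conv a b L = conv b a L := by
  unfold conv
  rw [← Finset.sum_range_reflect]
  refine Finset.sum_congr rfl fun m hm => ?_
  rw [Finset.mem_range] at hm
  rw [mul_comm]
  congr 2
  omega

/-- A sequence of weights `w`, with the tail `w (p + m) = c p * w' m` for `p > 0`. -/
structure TailWeight (R : Type*) [CommRing R] where
  w : ℕ → R
  tail : ℕ → R
  c : ℕ → R
  w_zero : w 0 = 1
  w_add : ∀ p m, 0 < p → w (p + m) = c p * tail m

open Classical in
/-- The weights relative to the lower end of an interval at distance `p`. -/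
noncomputable def TailWeight.shift (T : TailWeight R) (p : ℕ) : ℕ → R := if p = 0 then T.w else T.tail

open Classical in
/-- The factor split off by moving the lower end of an interval by `p`. -/
noncomputable def TailWeight.const (T : TailWeight R) (p : ℕ) : R := if p = 0 then 1 else T.c p

theorem TailWeight.w_add' (T : TailWeight R) (p m : ℕ) :
    T.w (p + m) = T.const p * T.shift p m := by
  unfold TailWeight.const TailWeight.shift
  split_ifs with h
  · simp [h]
  · exact T.w_add p m (Nat.pos_of_ne_zero h)

/-- If p and q are both zero or both positive, this is commutativity of convolution; the mixed cases
are the hypothesis. -/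
theorem conv_shift_symm (S T : TailWeight R) (h : ∀ L, conv S.w T.tail L = conv T.w S.tail L)
    (p q L : ℕ) : conv (S.shift p) (T.shift q) L = conv (T.shift p) (S.shift q) L := by
  unfold TailWeight.shift
  split_ifs
  · exact conv_comm _ _ _
  · exact h L
  · rw [conv_comm, ← h, conv_comm]
  · exact conv_comm _ _ _

/-- Write n = a + k. Then n - m = (a - m) + k and l - n = (l - b) + (b - a - k), and both weights
split off the constants of their fixed parts. -/
theorem sum_Icc_eq_conv (S T : TailWeight R) {m l a b : ℕ} (hma : m ≤ a) (hbl : b ≤ l)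
    (hab : a ≤ b) :
    ∑ n ∈ Icc a b, S.w (n - m) * T.w (l - n) =
      S.const (a - m) * T.const (l - b) * conv (S.shift (a - m)) (T.shift (l - b)) (b - a) := by
  have : Icc a b = Ico a (b + 1) := by ext; simp
  rw [this, Finset.sum_Ico_eq_sum_range, conv, Finset.mul_sum,
    show b + 1 - a = b - a + 1 by omega]
  refine Finset.sum_congr rfl fun k hk => ?_
  rw [Finset.mem_range] at hk
  rw [show a + k - m = (a - m) + k by omega, show l - (a + k) = (l - b) + (b - a - k) by omega,
    S.w_add', T.w_add']
  ring

/-- The upper bounds for a sequence interlacing `m` from above and `l` from below. -/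
def interlaceUpper (m l : ℕ → ℕ) : ℕ → ℕ
  | 0 => l 0
  | i + 1 => min (l (i + 1)) (m i)

theorem interlaceUpper_le (m l : ℕ → ℕ) (i : ℕ) : interlaceUpper m l i ≤ l i := by
  cases i with
  | zero => exact le_rfl
  | succ i => exact min_le_left _ _

/-- Each factor is a convolution times constants. The convolutions are symmetric in S and T one by
one; the constants only after taking the product over all i. -/
theorem prod_interlace_symm (S T : TailWeight R)
    (h : ∀ L, conv S.w T.tail L = conv T.w S.tail L) (m l : ℕ → ℕ) (N : ℕ)
    (hN : ∀ i, N ≤ i → l i = 0) :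
    ∏ i ∈ range N, ∑ n ∈ Icc (max (m i) (l (i + 1))) (interlaceUpper m l i),
        S.w (n - m i) * T.w (l i - n) =
      ∏ i ∈ range N, ∑ n ∈ Icc (max (m i) (l (i + 1))) (interlaceUpper m l i),
        T.w (n - m i) * S.w (l i - n) := by
  classical
  by_cases hne : ∀ i ∈ range N, max (m i) (l (i + 1)) ≤ interlaceUpper m l i
  swap
  · push Not at hne
    obtain ⟨i, hi, hlt⟩ := hne
    rw [Finset.prod_eq_zero hi, Finset.prod_eq_zero hi] <;>
      simp [Finset.Icc_eq_empty (not_le.2 hlt)]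
  -- The gap at the top of interval i + 1 equals the gap at the bottom of interval i, since l -
  -- min(l, m) = max(m, l) - m. The two gaps left over, at the top of the first interval and the
  -- bottom of the last, are zero.
  have hconst : ∀ T : TailWeight R, ∏ i ∈ range N, T.const (l i - interlaceUpper m l i) =
      ∏ i ∈ range N, T.const (max (m i) (l (i + 1)) - m i) := by
    intro T
    rcases N with _ | N
    · simp
    rw [Finset.prod_range_succ', Finset.prod_range_succ]
    congr 1
    · refine Finset.prod_congr rfl fun i _ => ?_
      congr 1
      simp only [interlaceUpper]
      omega
    · rw [hN (N + 1) le_rfl]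
      simp [interlaceUpper]
  have key : ∀ S T : TailWeight R,
      ∏ i ∈ range N, ∑ n ∈ Icc (max (m i) (l (i + 1))) (interlaceUpper m l i),
        S.w (n - m i) * T.w (l i - n) =
      (∏ i ∈ range N, S.const (max (m i) (l (i + 1)) - m i)) *
        (∏ i ∈ range N, T.const (max (m i) (l (i + 1)) - m i)) *
        ∏ i ∈ range N, conv (S.shift (max (m i) (l (i + 1)) - m i))
          (T.shift (l i - interlaceUpper m l i))
          (interlaceUpper m l i - max (m i) (l (i + 1))) := by
    intro S T
    rw [← hconst T, ← Finset.prod_mul_distrib, ← Finset.prod_mul_distrib]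
    exact Finset.prod_congr rfl fun i hi =>
      sum_Icc_eq_conv S T (le_max_left _ _) (interlaceUpper_le m l i) (hne i hi)
  rw [key S T, key T S, mul_comm (∏ i ∈ range N, S.const _)]
  congr 1
  exact Finset.prod_congr rfl fun i _ => conv_shift_symm S T h _ _ _

/-- The lengths of `lam` and `μ` interlace. For row lengths this says that `lam / μ` is a horizontal
strip, for column lengths that it is a vertical strip. -/
def Interlacing (len : YoungDiagram → ℕ → ℕ) (μ lam : YoungDiagram) : Prop :=
  ∀ i, len lam (i + 1) ≤ len μ i

open Classical in
/-- The operator that adds a strip, weighted by the lengths added. -/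
noncomputable def stripOp (len : YoungDiagram → ℕ → ℕ) (w : ℕ → R) : IA R :=
  ⟨fun μ lam => if μ ≤ lam ∧ Interlacing len μ lam then
    ∏ i ∈ range lam.card, w (len lam i - len μ i) else 0, fun _ _ h => if_neg fun h' => h h'.1⟩

theorem stripOp_apply {len : YoungDiagram → ℕ → ℕ} (hlen : IsLength len) {w : ℕ → R}
    (hw : w 0 = 1) {μ lam : YoungDiagram} {N : ℕ} (hN : lam.card ≤ N) (h1 : μ ≤ lam)
    (h2 : Interlacing len μ lam) :
    stripOp len w μ lam = ∏ i ∈ range N, w (len lam i - len μ i) := by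
  rw [stripOp, IncidenceAlgebra.coe_mk, if_pos ⟨h1, h2⟩]
  refine Finset.prod_subset (Finset.range_mono hN) fun i _ hi => ?_
  rw [hlen.eq_zero (by simpa using hi), Nat.zero_sub, hw]

theorem stripOp_apply_of_not {len : YoungDiagram → ℕ → ℕ} {w : ℕ → R} {μ lam : YoungDiagram}
    (h : ¬ Interlacing len μ lam) : stripOp len w μ lam = 0 := by
  rw [stripOp, IncidenceAlgebra.coe_mk, if_neg fun h' => h h'.2]

/-- For ν between μ and λ with both steps strips, the conditions read max(μᵢ, λᵢ₊₁) ≤ νᵢ ≤ min(λᵢ,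
μᵢ₋₁). These intervals are independent, so the sum over ν is a product. -/
theorem stripOp_mul_apply {len : YoungDiagram → ℕ → ℕ}
    (hlen : IsLength len) {w v : ℕ → R}
    (hw : w 0 = 1) (hv : v 0 = 1) {μ lam : YoungDiagram} (hle : μ ≤ lam) :
    (stripOp len w * stripOp len v) μ lam =
      ∏ i ∈ range lam.card,
        ∑ n ∈ Icc (max (len μ i) (len lam (i + 1))) (interlaceUpper (len μ) (len lam) i),
          w (n - len μ i) * v (len lam i - n) := by
  classical
  rw [IncidenceAlgebra.mul_apply, ← hlen.sum_prod
    ((Icc μ lam).filter fun ν => Interlacing len μ ν ∧ Interlacing len ν lam) lam.card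
    (fun i => max (len μ i) (len lam (i + 1))) (interlaceUpper (len μ) (len lam))
    (fun i n => w (n - len μ i) * v (len lam i - n))]
  · rw [Finset.sum_filter]
    refine Finset.sum_congr rfl fun ν hν => ?_
    rw [Finset.mem_Icc] at hν
    split_ifs with h
    · rw [stripOp_apply hlen hw (Finset.card_le_card (YoungDiagram.cells_subset_iff.2 hν.2)) hν.1
        h.1, stripOp_apply hlen hv le_rfl hν.2 h.2, Finset.prod_mul_distrib]
    · rw [not_and_or] at h
      rcases h with h | h
      · rw [stripOp_apply_of_not h, zero_mul]
      · rw [stripOp_apply_of_not h, mul_zero]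
  · intro i
    exact (min_le_right _ _).trans (le_max_left _ _)
  · intro i hi
    have := interlaceUpper_le (len μ) (len lam) i
    rw [hlen.eq_zero hi] at this
    omega
  · intro i hi
    have := hlen.le_iff.1 hle i
    rw [hlen.eq_zero hi] at this
    rw [hlen.eq_zero (by omega : lam.card ≤ i + 1)]
    omega
  · intro ν
    rw [Finset.mem_filter, Finset.mem_Icc, hlen.le_iff, hlen.le_iff]
    constructor
    · rintro ⟨⟨h1, h2⟩, h3, h4⟩ i
      refine ⟨max_le (h1 i) (h4 i), ?_⟩
      rcases i with _ | i
      · exact h2 0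
      · exact le_min (h2 _) (h3 i)
    · intro h
      refine ⟨⟨fun i => (le_max_left _ _).trans (h i).1,
        fun i => (h i).2.trans (interlaceUpper_le _ _ _)⟩,
        fun i => (h (i + 1)).2.trans (min_le_right _ _), fun i => (le_max_right _ _).trans (h i).1⟩

theorem stripOp_commute {len : YoungDiagram → ℕ → ℕ}
    (hlen : IsLength len) (S T : TailWeight R)
    (h : ∀ L, conv S.w T.tail L = conv T.w S.tail L) :
    stripOp len S.w * stripOp len T.w = stripOp len T.w * stripOp len S.w := by
  ext μ lam hle
  rw [stripOp_mul_apply hlen S.w_zero T.w_zero hle,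
    stripOp_mul_apply hlen T.w_zero S.w_zero hle]
  exact prod_interlace_symm S T h _ _ _ fun i hi => hlen.eq_zero hi

end Interlacing

/-! ### The operators attached to rows, columns and reverse plane partitions -/

section Operators

variable {R : Type*} [CommRing R]

theorem mem_skewCells_iff_rowLen {lam μ : YoungDiagram} {c : ℕ × ℕ} :
    c ∈ skewCells lam μ ↔ c.2 < lam.rowLen c.1 ∧ μ.rowLen c.1 ≤ c.2 := by
  rw [skewCells, Finset.mem_sdiff, YoungDiagram.mem_cells, YoungDiagram.mem_cells, ← not_lt,
    ← YoungDiagram.mem_iff_lt_rowLen, ← YoungDiagram.mem_iff_lt_rowLen]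

theorem mem_skewCells_iff_colLen {lam μ : YoungDiagram} {c : ℕ × ℕ} :
    c ∈ skewCells lam μ ↔ c.1 < lam.colLen c.2 ∧ μ.colLen c.2 ≤ c.1 := by
  rw [skewCells, Finset.mem_sdiff, YoungDiagram.mem_cells, YoungDiagram.mem_cells, ← not_lt,
    ← YoungDiagram.mem_iff_lt_colLen, ← YoungDiagram.mem_iff_lt_colLen]

theorem skewCells_self (lam : YoungDiagram) : skewCells lam lam = ∅ := by simp [skewCells]

theorem card_skewCells {μ lam : YoungDiagram} (h : μ ≤ lam) :
    (skewCells lam μ).card = lam.card - μ.card :=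
  Finset.card_sdiff_of_subset (YoungDiagram.cells_subset_iff.2 h)

theorem card_skewCells_eq_sum_rowLen {lam μ : YoungDiagram} :
    (skewCells lam μ).card = ∑ i ∈ range lam.card, (lam.rowLen i - μ.rowLen i) := by
  rw [Finset.card_eq_sum_card_fiberwise (f := Prod.fst) (t := range lam.card)]
  · refine Finset.sum_congr rfl fun i _ => ?_
    rw [← Nat.card_Ico, ← Finset.card_map (s := Ico _ _) ⟨fun j => (i, j), fun a b h => (Prod.mk.inj h).2⟩]
    refine congrArg Finset.card ?_
    ext ⟨a, b⟩
    simp only [mem_filter, mem_skewCells_iff_rowLen, Finset.mem_map, Finset.mem_Ico]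
    constructor
    · rintro ⟨h, rfl⟩
      exact ⟨b, ⟨h.2, h.1⟩, rfl⟩
    · rintro ⟨j, h, heq⟩
      obtain ⟨rfl, rfl⟩ := Prod.mk.inj heq
      exact ⟨⟨h.2, h.1⟩, rfl⟩
  · rintro c hc
    rw [Finset.mem_coe, Finset.mem_range]
    by_contra hlt
    have := (mem_skewCells_iff_rowLen.1 hc).1
    rw [rowLen_eq_zero (by simpa using hlt)] at this
    omega

theorem card_skewCells_eq_sum_colLen {lam μ : YoungDiagram} :
    (skewCells lam μ).card = ∑ i ∈ range lam.card, (lam.colLen i - μ.colLen i) := by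
  rw [Finset.card_eq_sum_card_fiberwise (f := Prod.snd) (t := range lam.card)]
  · refine Finset.sum_congr rfl fun i _ => ?_
    rw [← Nat.card_Ico, ← Finset.card_map (s := Ico _ _) ⟨fun j => (j, i), fun a b h => (Prod.mk.inj h).1⟩]
    refine congrArg Finset.card ?_
    ext ⟨a, b⟩
    simp only [mem_filter, mem_skewCells_iff_colLen, Finset.mem_map, Finset.mem_Ico]
    constructor
    · rintro ⟨h, rfl⟩
      exact ⟨a, ⟨h.2, h.1⟩, rfl⟩
    · rintro ⟨j, h, heq⟩
      obtain ⟨rfl, rfl⟩ := Prod.mk.inj heq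
      exact ⟨⟨h.2, h.1⟩, rfl⟩
  · rintro c hc
    rw [Finset.mem_coe, Finset.mem_range]
    by_contra hlt
    have := (mem_skewCells_iff_colLen.1 hc).1
    rw [colLen_eq_zero (by simpa using hlt)] at this
    omega

theorem numCols_eq {lam μ : YoungDiagram} :
    numCols lam μ = ((range lam.card).filter fun j => lam.colLen j - μ.colLen j ≠ 0).card := by
  rw [numCols]
  congr 1
  ext j
  simp only [Finset.mem_image, mem_skewCells_iff_colLen, mem_filter, Finset.mem_range]
  constructor
  · rintro ⟨c, ⟨h1, h2⟩, rfl⟩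
    refine ⟨?_, by omega⟩
    by_contra hlt
    rw [colLen_eq_zero (by simpa using hlt)] at h1
    omega
  · rintro ⟨_, h⟩
    exact ⟨(μ.colLen j, j), ⟨by dsimp only; omega, le_rfl⟩, rfl⟩

theorem numCols_eq_zero_iff {lam μ : YoungDiagram} (h : μ ≤ lam) : numCols lam μ = 0 ↔ μ = lam := by
  rw [numCols, Finset.card_eq_zero, Finset.image_eq_empty, skewCells, Finset.sdiff_eq_empty_iff_subset,
    YoungDiagram.cells_subset_iff]
  exact ⟨fun h' => le_antisymm h h', fun h' => h'.ge⟩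

theorem card_skewCells_eq_zero_iff {lam μ : YoungDiagram} (h : μ ≤ lam) :
    (skewCells lam μ).card = 0 ↔ μ = lam := by
  rw [Finset.card_eq_zero, skewCells, Finset.sdiff_eq_empty_iff_subset,
    YoungDiagram.cells_subset_iff]
  exact ⟨fun h' => le_antisymm h h', fun h' => h'.ge⟩

theorem isVerticalStrip_iff {lam μ : YoungDiagram} :
    IsVerticalStrip lam μ ↔ Interlacing YoungDiagram.colLen μ lam := by
  constructor
  · intro h j
    by_contra! hlt
    have h1 := lam.colLen_anti j (j + 1) (by omega)
    have h2 := μ.colLen_anti j (j + 1) (by omega)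
    have := h (μ.colLen j, j) (mem_skewCells_iff_colLen.2 ⟨by dsimp only; omega, le_rfl⟩)
      (μ.colLen j, j + 1) (mem_skewCells_iff_colLen.2 ⟨hlt, h2⟩) rfl
    simp at this
  · have key : ∀ {i j₁ j₂ : ℕ}, Interlacing YoungDiagram.colLen μ lam → (i, j₁) ∈ skewCells lam μ →
        (i, j₂) ∈ skewCells lam μ → ¬ j₁ < j₂ := by
      intro i j₁ j₂ h ha hb hlt
      have h1 := (mem_skewCells_iff_colLen.1 ha).2
      have h2 := (mem_skewCells_iff_colLen.1 hb).1
      have h3 := lam.colLen_anti (j₁ + 1) j₂ hlt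
      have h4 := h j₁
      dsimp only at h1 h2
      omega
    rintro h ⟨i, j₁⟩ ha ⟨i', j₂⟩ hb hi
    obtain rfl : i = i' := hi
    have h1 := key h ha hb
    have h2 := key h hb ha
    rw [Prod.mk.injEq]
    omega

open Classical in
/-- The operator with entries `x ^ e μ lam` on the pairs of diagrams that satisfy `P`. -/
noncomputable def transfer (P : YoungDiagram → YoungDiagram → Prop)
    (e : YoungDiagram → YoungDiagram → ℕ) (x : R) : IA R :=
  ⟨fun μ lam => if μ ≤ lam ∧ P μ lam then x ^ e μ lam else 0, fun _ _ h => if_neg fun h' => h h'.1⟩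

theorem transfer_apply {P : YoungDiagram → YoungDiagram → Prop}
    {e : YoungDiagram → YoungDiagram → ℕ} (x : R) {μ lam : YoungDiagram} (h : μ ≤ lam)
    (hP : P μ lam) : transfer P e x μ lam = x ^ e μ lam := if_pos ⟨h, hP⟩

theorem transfer_apply_of_not {P : YoungDiagram → YoungDiagram → Prop}
    {e : YoungDiagram → YoungDiagram → ℕ} (x : R) {μ lam : YoungDiagram}
    (hP : ¬ P μ lam) : transfer P e x μ lam = 0 := if_neg fun h => hP h.2

theorem iaMap_transfer {S : Type*} [CommRing S] (φ : R →+* S)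
    (P : YoungDiagram → YoungDiagram → Prop) (e : YoungDiagram → YoungDiagram → ℕ) (x : R) :
    iaMap φ (transfer P e x) = transfer P e (φ x) := by
  ext μ lam _
  simp only [iaMap_apply, transfer, IncidenceAlgebra.coe_mk]
  split_ifs <;> simp

theorem transfer_self {P : YoungDiagram → YoungDiagram → Prop}
    {e : YoungDiagram → YoungDiagram → ℕ} (hP : ∀ μ, P μ μ)
    (he : ∀ μ lam, μ ≤ lam → (e μ lam = 0 ↔ μ = lam)) (x : R) (μ : YoungDiagram) :
    transfer P e x μ μ = 1 := by
  rw [transfer, IncidenceAlgebra.coe_mk, if_pos ⟨le_rfl, hP μ⟩, (he μ μ le_rfl).2 rfl, pow_zero]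

theorem transfer_zero {P : YoungDiagram → YoungDiagram → Prop}
    {e : YoungDiagram → YoungDiagram → ℕ} (hP : ∀ μ, P μ μ)
    (he : ∀ μ lam, μ ≤ lam → (e μ lam = 0 ↔ μ = lam)) : transfer P e (0 : R) = 1 := by
  ext μ lam hle
  rw [IncidenceAlgebra.one_apply]
  split_ifs with h
  · rw [← h, transfer_self hP he]
  · rw [transfer, IncidenceAlgebra.coe_mk]
    split_ifs
    · exact zero_pow fun h' => h ((he _ _ hle).1 h')
    · rfl

/-- The operator that adds boxes, counted by the number of columns they occupy. -/
noncomputable def colOp (x : R) : IA R := transfer (fun _ _ => True) (fun μ lam => numCols lam μ) x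

/-- The operator that adds a horizontal strip. -/
noncomputable def horizOp (x : R) : IA R :=
  transfer (Interlacing YoungDiagram.rowLen) (fun μ lam => (skewCells lam μ).card) x

theorem interlacing_self {len : YoungDiagram → ℕ → ℕ} (h : ∀ μ i, len μ (i + 1) ≤ len μ i)
    (μ : YoungDiagram) : Interlacing len μ μ := h μ

theorem interlacing_rowLen_self (μ : YoungDiagram) : Interlacing YoungDiagram.rowLen μ μ :=
  interlacing_self (fun μ i => μ.rowLen_anti i (i + 1) (Nat.le_succ i)) μ

/-- The weights of horizontal strips. -/
def powWeight (x : R) : TailWeight R where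
  w n := x ^ n
  tail n := x ^ n
  c n := x ^ n
  w_zero := pow_zero x
  w_add p m _ := pow_add x p m

/-- The weights of vertical strips. -/
def vertWeight (t : R) : TailWeight R where
  w n := if n = 0 then 1 else t * (t + 1) ^ (n - 1)
  tail n := (t + 1) ^ n
  c n := t * (t + 1) ^ (n - 1)
  w_zero := if_pos rfl
  w_add p m hp := by
    rw [if_neg (by omega), show p + m - 1 = (p - 1) + m by omega, pow_add, mul_assoc]

theorem vertWeight_w_succ (t : R) (n : ℕ) : (vertWeight t).w (n + 1) = t * (t + 1) ^ n := by
  simp [vertWeight]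

theorem conv_vertWeight_succ (s t : R) (L : ℕ) :
    conv (vertWeight s).w (vertWeight t).tail (L + 1) =
      (t + 1) ^ (L + 1) + s * ∑ m ∈ range (L + 1), (s + 1) ^ m * (t + 1) ^ (L - m) := by
  rw [conv, Finset.sum_range_succ', add_comm, (vertWeight s).w_zero, Finset.mul_sum]
  congr 1
  · simp [vertWeight]
  · refine Finset.sum_congr rfl fun m _ => ?_
    rw [vertWeight_w_succ, Nat.add_sub_add_right, mul_assoc]
    rfl

/-- For L + 1, exchanging s and t changes the sum by (t+1)^(L+1) - (s+1)^(L+1) + (s - t)·∑ (s+1)^m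
(t+1)^(L-m), which is zero by the geometric sum. -/
theorem conv_vertWeight (s t : R) (L : ℕ) :
    conv (vertWeight s).w (vertWeight t).tail L = conv (vertWeight t).w (vertWeight s).tail L := by
  rcases L with _ | L
  · simp [conv, vertWeight]
  · rw [conv_vertWeight_succ, conv_vertWeight_succ]
    have h1 : ∑ m ∈ range (L + 1), (t + 1) ^ m * (s + 1) ^ (L - m) =
        ∑ m ∈ range (L + 1), (s + 1) ^ m * (t + 1) ^ (L - m) :=
      conv_comm (fun m => (t + 1) ^ m) (fun m => (s + 1) ^ m) L
    have h2 := (Commute.all (s + 1) (t + 1)).geom_sum₂_mul (L + 1)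
    simp only [Nat.add_sub_cancel] at h2
    rw [h1]
    linear_combination h2

theorem horizOp_eq (x : R) : horizOp x = stripOp YoungDiagram.rowLen (powWeight x).w := by
  ext μ lam _
  simp only [horizOp, transfer, stripOp, IncidenceAlgebra.coe_mk]
  split_ifs
  · rw [card_skewCells_eq_sum_rowLen]
    exact (Finset.prod_pow_eq_pow_sum _ _ _).symm
  · rfl

theorem horizOp_commute (x y : R) : Commute (horizOp x) (horizOp y) := by
  rw [horizOp_eq, horizOp_eq]
  exact stripOp_commute isLength_rowLen _ _ fun L => conv_comm (fun n => x ^ n) (fun n => y ^ n) L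

/-- The operator that adds a vertical strip. -/
noncomputable def vertOp (t : R) : IA R := stripOp YoungDiagram.colLen (vertWeight t).w

/-- The inequality is carried along in the induction because the exponent of t + 1 is a truncated
subtraction. -/
theorem prod_vertWeight (t : R) (d : ℕ → ℕ) (s : Finset ℕ) :
    (s.filter fun j => d j ≠ 0).card ≤ ∑ j ∈ s, d j ∧
    ∏ j ∈ s, (vertWeight t).w (d j) = t ^ (s.filter fun j => d j ≠ 0).card *
      (t + 1) ^ (∑ j ∈ s, d j - (s.filter fun j => d j ≠ 0).card) := by
  induction s using Finset.induction_on with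
  | empty => simp
  | insert a s ha ih =>
    rw [Finset.prod_insert ha, Finset.sum_insert ha, Finset.filter_insert, ih.2]
    split_ifs with h
    · obtain ⟨k, hk⟩ := Nat.exists_eq_succ_of_ne_zero h
      rw [Finset.card_insert_of_notMem (by simp [ha]), hk, vertWeight_w_succ]
      refine ⟨by omega, ?_⟩
      rw [show k.succ + ∑ j ∈ s, d j - ((s.filter fun j => d j ≠ 0).card + 1) =
        k + (∑ j ∈ s, d j - (s.filter fun j => d j ≠ 0).card) by have := ih.1; omega, pow_add]
      ring
    · rw [not_not] at h
      rw [h, (vertWeight t).w_zero, zero_add, one_mul]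
      exact ⟨ih.1, rfl⟩

theorem vertOp_apply (t : R) {μ lam : YoungDiagram} (h : μ ≤ lam) :
    vertOp t μ lam = if IsVerticalStrip lam μ then
      t ^ numCols lam μ * (t + 1) ^ ((skewCells lam μ).card - numCols lam μ) else 0 := by
  split_ifs with hv
  · rw [vertOp, stripOp_apply isLength_colLen (vertWeight t).w_zero le_rfl h
      (isVerticalStrip_iff.1 hv), numCols_eq, card_skewCells_eq_sum_colLen]
    exact (prod_vertWeight t _ _).2
  · exact stripOp_apply_of_not fun h' => hv (isVerticalStrip_iff.2 h')

theorem colOp_apply (x : R) {μ lam : YoungDiagram} (h : μ ≤ lam) :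
    colOp x μ lam = x ^ numCols lam μ := by
  simp [colOp, transfer, h]

theorem colOp_apply_eq_prod (x : R) {μ lam : YoungDiagram} {N : ℕ} (hN : lam.card ≤ N) (h : μ ≤ lam) :
    colOp x μ lam =
      ∏ j ∈ range N, if lam.colLen j - μ.colLen j ≠ 0 then x else 1 := by
  rw [colOp_apply x h, numCols_eq, ← Finset.prod_subset (Finset.range_mono hN),
    ← Finset.prod_filter, Finset.prod_const]
  intro j _ hj
  rw [colLen_eq_zero (by simpa using hj), Nat.zero_sub, if_neg (by simp)]

theorem sum_vertWeight (t : R) (k : ℕ) :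
    ∑ i ∈ range (k + 1), (vertWeight t).w i = (t + 1) ^ k := by
  induction k with
  | zero => simp [vertWeight]
  | succ k ih =>
    rw [Finset.sum_range_succ, ih, vertWeight_w_succ]
    ring

/-- With l = m + k + 1, the terms n < l add up to -t (t+1)^k by `sum_vertWeight`, and the term n = l
is t (t+1)^k. -/
theorem sum_Icc_vertWeight_mul (t : R) {m l : ℕ} (h : m < l) :
    ∑ n ∈ Icc m l, (vertWeight t).w (n - m) * (if l - n ≠ 0 then -t else 1) = 0 := by
  obtain ⟨k, rfl⟩ : ∃ k, l = m + k + 1 := ⟨l - m - 1, by omega⟩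
  have : Icc m (m + k + 1) = Ico m (m + (k + 2)) := by ext; simp; omega
  rw [this, Finset.sum_Ico_eq_sum_range, Nat.add_sub_cancel_left, Finset.sum_range_succ,
    Finset.sum_congr rfl (g := fun i => (vertWeight t).w i * (-t)), ← Finset.sum_mul,
    sum_vertWeight, if_neg (by omega), Nat.add_sub_cancel_left, vertWeight_w_succ]
  · ring
  · intro i hi
    rw [Finset.mem_range] at hi
    rw [if_pos (by omega), Nat.add_sub_cancel_left]

theorem vertOp_self (t : R) (a : YoungDiagram) : vertOp t a a = 1 := by
  rw [vertOp_apply t le_rfl, if_pos]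
  · simp [numCols, skewCells_self]
  · simp [IsVerticalStrip, skewCells_self]

theorem colOp_self (t : R) (a : YoungDiagram) : colOp t a a = 1 := by
  simp [colOp_apply, numCols, skewCells_self]

/-- An off-diagonal entry is a product over columns of sums over the intermediate column length, and
one of these sums vanishes. -/
theorem vertOp_mul_colOp (t : R) : vertOp t * colOp (-t) = 1 := by
  classical
  ext μ lam hle
  rw [IncidenceAlgebra.one_apply]
  split_ifs with heq
  · rw [← heq, ia_mul_self, vertOp_self, colOp_self, one_mul]
  have hsum : (vertOp t * colOp (-t)) μ lam = ∏ j ∈ range lam.card,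
      ∑ n ∈ Icc (μ.colLen j) (interlaceUpper μ.colLen lam.colLen j),
        (vertWeight t).w (n - μ.colLen j) * (if lam.colLen j - n ≠ 0 then -t else 1) := by
    rw [IncidenceAlgebra.mul_apply, ← isLength_colLen.sum_prod
      ((Icc μ lam).filter fun ν => Interlacing YoungDiagram.colLen μ ν) lam.card
      μ.colLen (interlaceUpper μ.colLen lam.colLen)
      (fun i n => (vertWeight t).w (n - μ.colLen i) * (if lam.colLen i - n ≠ 0 then -t else 1))]
    · rw [Finset.sum_filter]
      refine Finset.sum_congr rfl fun ν hν => ?_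
      rw [Finset.mem_Icc] at hν
      split_ifs with h
      · rw [vertOp, stripOp_apply isLength_colLen (vertWeight t).w_zero
          (Finset.card_le_card (YoungDiagram.cells_subset_iff.2 hν.2)) hν.1 h,
          colOp_apply_eq_prod _ le_rfl hν.2, Finset.prod_mul_distrib]
      · rw [vertOp, stripOp_apply_of_not h, zero_mul]
    · intro i
      exact min_le_right _ _
    · intro i hi
      have := interlaceUpper_le μ.colLen lam.colLen i
      rw [colLen_eq_zero hi] at this
      omega
    · intro i hi
      have := le_iff_colLen.1 hle i
      rw [colLen_eq_zero hi] at this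
      omega
    · intro ν
      rw [Finset.mem_filter, Finset.mem_Icc, le_iff_colLen, le_iff_colLen]
      constructor
      · rintro ⟨⟨h1, h2⟩, h3⟩ i
        refine ⟨h1 i, ?_⟩
        rcases i with _ | i
        · exact h2 0
        · exact le_min (h2 _) (h3 i)
      · intro h
        exact ⟨⟨fun i => (h i).1, fun i => (h i).2.trans (interlaceUpper_le _ _ _)⟩,
          fun i => (h (i + 1)).2.trans (min_le_right _ _)⟩
  rw [hsum]
  -- In the first column j where the diagrams differ, the bound by μ's column j - 1 is vacuous,
  -- because that column agrees with λ's. The sum then runs over the whole interval up to λ's column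
  -- length and is zero.
  have hex : ∃ j, μ.colLen j ≠ lam.colLen j := by
    by_contra! hc
    exact heq (isLength_colLen.ext hc)
  have hj := Nat.find_spec hex
  have hmin : ∀ i, i < Nat.find hex → μ.colLen i = lam.colLen i := fun i hi => by
    simpa using Nat.find_min hex hi
  generalize Nat.find hex = j at hj hmin
  have hlt := lt_of_le_of_ne (le_iff_colLen.1 hle j) hj
  refine Finset.prod_eq_zero (i := j) ?_ ?_
  · rw [Finset.mem_range]
    by_contra hc
    rw [colLen_eq_zero (not_lt.1 hc)] at hlt
    omega
  · have : interlaceUpper μ.colLen lam.colLen j = lam.colLen j := by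
      rcases j with _ | j
      · rfl
      · refine min_eq_left ?_
        rw [hmin j (Nat.lt_succ_self j)]
        exact lam.colLen_anti j (j + 1) (Nat.le_succ j)
    rw [this]
    exact sum_Icc_vertWeight_mul t hlt

/-- `colOp` is not itself a strip operator. Instead, `vertOp (-x) * vertOp (-y)` is a left inverse
of both products of `colOp x` and `colOp y`, and it is left cancellable. -/
theorem colOp_commute (x y : R) : Commute (colOp x) (colOp y) := by
  have hcomm : vertOp (-x) * vertOp (-y) = vertOp (-y) * vertOp (-x) :=
    stripOp_commute isLength_colLen _ _ (conv_vertWeight (-x) (-y))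
  have h1 : ∀ x y : R, vertOp (-x) * vertOp (-y) * (colOp y * colOp x) = 1 := by
    intro x y
    have hx := vertOp_mul_colOp (-x)
    have hy := vertOp_mul_colOp (-y)
    rw [neg_neg] at hx hy
    rw [mul_assoc, ← mul_assoc (vertOp (-y)), hy, one_mul, hx]
  have h2 : vertOp (-x) * vertOp (-y) * (colOp x * colOp y - colOp y * colOp x) = 0 := by
    rw [mul_sub, h1, hcomm, h1, sub_self]
  refine sub_eq_zero.1 (ia_eq_zero_of_mul_eq_zero (fun a => ?_) h2)
  rw [ia_mul_self, vertOp_self, vertOp_self, one_mul]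
  exact isUnit_one

end Operators

/-! ### Reverse plane partitions as chains of diagrams -/

section Chains

namespace ReversePlanePartition

variable {lam μ : YoungDiagram}

theorem mem_skewCells {lam μ : YoungDiagram} {c : ℕ × ℕ} :
    c ∈ skewCells lam μ ↔ c ∈ lam ∧ c ∉ μ := by
  rw [skewCells, Finset.mem_sdiff, YoungDiagram.mem_cells, YoungDiagram.mem_cells]

theorem entry_mono (T : ReversePlanePartition lam μ) {a b c d : ℕ} (hac : a ≤ c) (hbd : b ≤ d)
    (h1 : (a, b) ∈ skewCells lam μ) (h2 : (c, d) ∈ skewCells lam μ) :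
    T.entry a b ≤ T.entry c d := by
  have h3 : (a, d) ∈ skewCells lam μ := mem_skewCells.2
    ⟨lam.up_left_mem hac le_rfl (mem_skewCells.1 h2).1,
      fun h => (mem_skewCells.1 h1).2 (μ.up_left_mem le_rfl hbd h)⟩
  refine le_trans (b := T.entry a d) ?_ ?_
  · rcases hbd.eq_or_lt with rfl | h
    · exact le_rfl
    · exact T.row_weak h h1 h3
  · rcases hac.eq_or_lt with rfl | h
    · exact le_rfl
    · exact T.col_weak h h3 h2

/-- The diagram formed by `μ` and the boxes with entry less than `k`. -/
def sub (T : ReversePlanePartition lam μ) (k : ℕ) : YoungDiagram where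
  cells := lam.cells.filter fun c => c ∈ μ ∨ T.entry c.1 c.2 < k
  isLowerSet := by
    rintro ⟨a, b⟩ ⟨c, d⟩ h hab
    simp only [coe_filter, Set.mem_ofPred_eq, YoungDiagram.mem_cells] at hab ⊢
    have hcd : (c, d) ∈ lam := lam.up_left_mem h.1 h.2 hab.1
    refine ⟨hcd, ?_⟩
    by_cases hμ : (c, d) ∈ μ
    · exact Or.inl hμ
    have hab' : (a, b) ∉ μ := fun h' => hμ (μ.up_left_mem h.1 h.2 h')
    exact Or.inr ((T.entry_mono h.1 h.2 (mem_skewCells.2 ⟨hcd, hμ⟩)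
      (mem_skewCells.2 ⟨hab.1, hab'⟩)).trans_lt (hab.2.resolve_left hab'))

theorem mem_sub {T : ReversePlanePartition lam μ} {k : ℕ} {c : ℕ × ℕ} :
    c ∈ T.sub k ↔ c ∈ lam ∧ (c ∈ μ ∨ T.entry c.1 c.2 < k) := by
  rw [← YoungDiagram.mem_cells, sub, Finset.mem_filter, YoungDiagram.mem_cells]

theorem sub_le (T : ReversePlanePartition lam μ) (k : ℕ) : T.sub k ≤ lam :=
  fun _ hc => (mem_sub.1 hc).1

theorem le_sub (h : μ ≤ lam) (T : ReversePlanePartition lam μ) (k : ℕ) : μ ≤ T.sub k :=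
  fun _ hc => mem_sub.2 ⟨h hc, Or.inl hc⟩

theorem sub_mono (T : ReversePlanePartition lam μ) {k k' : ℕ} (h : k ≤ k') : T.sub k ≤ T.sub k' :=
  fun _ hc => mem_sub.2 ⟨(mem_sub.1 hc).1, (mem_sub.1 hc).2.imp_right fun h' => h'.trans_le h⟩

theorem sub_zero (h : μ ≤ lam) (T : ReversePlanePartition lam μ) : T.sub 0 = μ :=
  le_antisymm (fun _ hc => (mem_sub.1 hc).2.resolve_right (Nat.not_lt_zero _)) (le_sub h T 0)

theorem sub_eq_top_of_le {T : ReversePlanePartition lam μ} {N k : ℕ} (h : T.sub N = lam)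
    (hk : N ≤ k) : T.sub k = lam :=
  le_antisymm (T.sub_le k) (h.symm.le.trans (T.sub_mono hk))

theorem entry_lt {T : ReversePlanePartition lam μ} {N : ℕ} (h : T.sub N = lam) {i j : ℕ}
    (hc : (i, j) ∈ skewCells lam μ) : T.entry i j < N :=
  (mem_sub.1 (h.symm ▸ (mem_skewCells.1 hc).1 : (i, j) ∈ T.sub N)).2.resolve_left
    (mem_skewCells.1 hc).2

theorem skewCells_sub_succ (T : ReversePlanePartition lam μ) (k : ℕ) :
    skewCells (T.sub (k + 1)) (T.sub k) =
      (skewCells lam μ).filter fun c => T.entry c.1 c.2 = k := by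
  ext c
  rw [mem_skewCells, mem_sub, mem_sub, Finset.mem_filter, mem_skewCells]
  constructor
  · rintro ⟨⟨h1, h2⟩, h3⟩
    have h4 : ¬ (c ∈ μ ∨ T.entry c.1 c.2 < k) := fun h => h3 ⟨h1, h⟩
    rw [not_or] at h4
    have := h2.resolve_left h4.1
    exact ⟨⟨h1, h4.1⟩, by omega⟩
  · rintro ⟨⟨h1, h2⟩, h3⟩
    refine ⟨⟨h1, Or.inr (by omega)⟩, ?_⟩
    rintro ⟨_, h | h⟩
    · exact h2 h
    · omega

theorem finite_sub_eq (lam μ : YoungDiagram) (N : ℕ) :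
    Finite {T : ReversePlanePartition lam μ // T.sub N = lam} := by
  refine Finite.of_injective (β := lam.cells → Fin (N + 1))
    -- All entries inside the shape are less than N here, so the minimum only supplies the bound and
    -- loses nothing.
    (fun T c => ⟨min (T.1.entry c.1.1 c.1.2) N, by omega⟩) ?_
  rintro ⟨T, hT⟩ ⟨T', hT'⟩ h
  refine Subtype.ext (ReversePlanePartition.ext ?_)
  funext i j
  dsimp only
  by_cases hc : (i, j) ∈ skewCells lam μ
  · have h1 := congrArg Fin.val (congrFun h ⟨(i, j), (Finset.mem_sdiff.1 hc).1⟩)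
    have h2 := entry_lt hT hc
    have h3 := entry_lt hT' hc
    dsimp only at h1
    omega
  · rw [T.zeros hc, T'.zeros hc]

/-- The restriction of a reverse plane partition to a smaller diagram. -/
noncomputable def restrict (T : ReversePlanePartition lam μ) {ν : YoungDiagram} (h : ν ≤ lam) :
    ReversePlanePartition ν μ where
  entry i j := if (i, j) ∈ skewCells ν μ then T.entry i j else 0
  row_weak := by
    intro i j₁ j₂ hj h1 h2
    rw [if_pos h1, if_pos h2]
    rw [mem_skewCells] at h1 h2
    exact T.row_weak hj (mem_skewCells.2 ⟨h h1.1, h1.2⟩) (mem_skewCells.2 ⟨h h2.1, h2.2⟩)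
  col_weak := by
    intro i j₁ j₂ hj h1 h2
    rw [if_pos h1, if_pos h2]
    rw [mem_skewCells] at h1 h2
    exact T.col_weak hj (mem_skewCells.2 ⟨h h1.1, h1.2⟩) (mem_skewCells.2 ⟨h h2.1, h2.2⟩)
  zeros := fun h => if_neg h

/-- The extension of a reverse plane partition with entries less than `N` to a larger diagram, by
the entry `N`. -/
noncomputable def extend {ν : YoungDiagram} (T : ReversePlanePartition ν μ) (lam : YoungDiagram)
    (N : ℕ) : ReversePlanePartition lam μ where
  entry i j := if (i, j) ∈ skewCells lam μ then
    if (i, j) ∈ ν then min (T.entry i j) N else N else 0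
  row_weak := by
    intro i j₁ j₂ hj h1 h2
    rw [if_pos h1, if_pos h2]
    by_cases h3 : (i, j₂) ∈ ν
    · have h4 : (i, j₁) ∈ ν := ν.up_left_mem le_rfl hj.le h3
      rw [if_pos h3, if_pos h4]
      exact min_le_min_right _ (T.row_weak hj (mem_skewCells.2 ⟨h4, (mem_skewCells.1 h1).2⟩)
        (mem_skewCells.2 ⟨h3, (mem_skewCells.1 h2).2⟩))
    · rw [if_neg h3]
      split_ifs
      · exact min_le_right _ _
      · exact le_rfl
  col_weak := by
    intro i₁ i₂ j hi h1 h2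
    rw [if_pos h1, if_pos h2]
    by_cases h3 : (i₂, j) ∈ ν
    · have h4 : (i₁, j) ∈ ν := ν.up_left_mem hi.le le_rfl h3
      rw [if_pos h3, if_pos h4]
      exact min_le_min_right _ (T.col_weak hi (mem_skewCells.2 ⟨h4, (mem_skewCells.1 h1).2⟩)
        (mem_skewCells.2 ⟨h3, (mem_skewCells.1 h2).2⟩))
    · rw [if_neg h3]
      split_ifs
      · exact min_le_right _ _
      · exact le_rfl
  zeros := fun h => if_neg h

theorem restrict_entry (T : ReversePlanePartition lam μ) {ν : YoungDiagram} (h : ν ≤ lam) {i j : ℕ}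
    (hc : (i, j) ∈ skewCells ν μ) : (T.restrict h).entry i j = T.entry i j := if_pos hc

theorem extend_entry_of_mem {ν : YoungDiagram} (T : ReversePlanePartition ν μ) (N : ℕ) {i j : ℕ}
    (hc : (i, j) ∈ skewCells lam μ) (hν : (i, j) ∈ ν) :
    (T.extend lam N).entry i j = min (T.entry i j) N := (if_pos hc).trans (if_pos hν)

theorem extend_entry_of_notMem {ν : YoungDiagram} (T : ReversePlanePartition ν μ) (N : ℕ)
    {i j : ℕ} (hc : (i, j) ∈ skewCells lam μ) (hν : (i, j) ∉ ν) :
    (T.extend lam N).entry i j = N := (if_pos hc).trans (if_neg hν)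

theorem restrict_sub (hμ : μ ≤ lam) (T : ReversePlanePartition lam μ) {ν : YoungDiagram} {N k : ℕ}
    (hN : T.sub N = ν) (h : ν ≤ lam) (hk : k ≤ N) : (T.restrict h).sub k = T.sub k := by
  ext c
  rw [YoungDiagram.mem_cells, YoungDiagram.mem_cells, mem_sub (T := T.restrict h), mem_sub (T := T)]
  by_cases hc : c ∈ μ
  · have : c ∈ ν := hN ▸ le_sub hμ T N hc
    simp [hc, hμ hc, this]
  · by_cases hcN : c ∈ ν
    · rw [T.restrict_entry h (mem_skewCells.2 ⟨hcN, hc⟩)]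
      simp [hcN, h hcN]
    · simp only [hcN, hc, false_or, false_and, false_iff, not_and]
      intro h1 h2
      exact hcN (hN ▸ mem_sub.2 ⟨h1, Or.inr (h2.trans_le hk)⟩)

theorem extend_sub {ν : YoungDiagram} (hμ : μ ≤ ν) (h : ν ≤ lam) (T : ReversePlanePartition ν μ)
    {N k : ℕ} (hk : k ≤ N) : (T.extend lam N).sub k = T.sub k := by
  ext c
  rw [YoungDiagram.mem_cells, YoungDiagram.mem_cells, mem_sub (T := T.extend lam N), mem_sub (T := T)]
  by_cases hc : c ∈ μ
  · simp [hc, hμ hc, h (hμ hc)]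
  · by_cases hcν : c ∈ ν
    · rw [T.extend_entry_of_mem N (mem_skewCells.2 ⟨h hcν, hc⟩) hcν]
      simp only [h hcν, hc, hcν, true_and, false_or]
      omega
    · simp only [hcν, hc, false_or, false_and, iff_false, not_and, not_lt]
      intro h1
      rw [T.extend_entry_of_notMem N (mem_skewCells.2 ⟨h1, hc⟩) hcν]
      exact hk

theorem extend_sub_succ {ν : YoungDiagram} (T : ReversePlanePartition ν μ) (lam : YoungDiagram)
    (N : ℕ) : (T.extend lam N).sub (N + 1) = lam := by
  refine le_antisymm (sub_le _ _) fun c hc => mem_sub.2 ⟨hc, ?_⟩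
  by_cases hcμ : c ∈ μ
  · exact Or.inl hcμ
  · refine Or.inr ?_
    by_cases hcν : c ∈ ν
    · rw [T.extend_entry_of_mem N (mem_skewCells.2 ⟨hc, hcμ⟩) hcν]
      exact Nat.lt_succ_of_le (min_le_right _ _)
    · rw [T.extend_entry_of_notMem N (mem_skewCells.2 ⟨hc, hcμ⟩) hcν]
      exact Nat.lt_succ_self N

theorem extend_restrict (T : ReversePlanePartition lam μ) {ν : YoungDiagram} {N : ℕ}
    (hN : T.sub N = ν) (h : ν ≤ lam) (hT : T.sub (N + 1) = lam) :
    (T.restrict h).extend lam N = T := by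
  ext i j
  by_cases hc : (i, j) ∈ skewCells lam μ
  · have hlt := entry_lt hT hc
    have hc' := mem_skewCells.1 hc
    by_cases hν : (i, j) ∈ ν
    · rw [extend_entry_of_mem _ _ hc hν, restrict_entry _ _ (mem_skewCells.2 ⟨hν, hc'.2⟩)]
      rw [← hN] at hν
      have := (mem_sub.1 hν).2.resolve_left hc'.2
      dsimp only at this
      omega
    · rw [extend_entry_of_notMem _ _ hc hν]
      have : ¬ T.entry i j < N := fun h' => hν (hN ▸ mem_sub.2 ⟨hc'.1, Or.inr h'⟩)
      omega
  · rw [zeros _ hc, zeros _ hc]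

theorem restrict_extend {ν : YoungDiagram} (h : ν ≤ lam) (T : ReversePlanePartition ν μ)
    {N : ℕ} (hN : T.sub N = ν) : (T.extend lam N).restrict h = T := by
  ext i j
  by_cases hc : (i, j) ∈ skewCells ν μ
  · have hlt := entry_lt hN hc
    have hc' := mem_skewCells.1 hc
    rw [restrict_entry _ _ hc, extend_entry_of_mem _ _ (mem_skewCells.2 ⟨h hc'.1, hc'.2⟩) hc'.1]
    omega
  · rw [zeros _ hc, zeros _ hc]

/-- The steps of the chain of diagrams of `T` satisfy `P`, and `e` takes the values `d` on them. -/
def IsAdmissible (P : YoungDiagram → YoungDiagram → Prop) (e : YoungDiagram → YoungDiagram → ℕ)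
    (d : ℕ → ℕ) (T : ReversePlanePartition lam μ) : Prop :=
  ∀ k, P (T.sub k) (T.sub (k + 1)) ∧ e (T.sub k) (T.sub (k + 1)) = d k

variable {P : YoungDiagram → YoungDiagram → Prop} {e : YoungDiagram → YoungDiagram → ℕ}

/-- From index N on the chain is constant, while each box of λ appears in it eventually. -/
theorem sub_eq_of_isAdmissible (he : ∀ μ lam, μ ≤ lam → (e μ lam = 0 ↔ μ = lam))
    {d : ℕ → ℕ} {N : ℕ} (hd : ∀ k, N ≤ k → d k = 0) {T : ReversePlanePartition lam μ}
    (hT : T.IsAdmissible P e d) : T.sub N = lam := by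
  have h1 : ∀ k, T.sub (N + k) = T.sub N := by
    intro k
    induction k with
    | zero => rfl
    | succ k ih =>
      rw [← ih]
      refine ((he _ _ (T.sub_mono (Nat.le_succ _))).1 ?_).symm
      exact ((hT _).2).trans (hd _ (Nat.le_add_right N k))
  refine le_antisymm (T.sub_le N) fun c hc => ?_
  rw [← h1 (T.entry c.1 c.2 + 1)]
  exact mem_sub.2 ⟨hc, Or.inr (by omega)⟩

/-- Removing the largest entry `N` of the reverse plane partitions in which the entries less than
`N` fill `ν / μ`. -/
noncomputable def removeLargest (hP : ∀ μ, P μ μ)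
    (he : ∀ μ lam, μ ≤ lam → (e μ lam = 0 ↔ μ = lam)) {ν : YoungDiagram} (hμ : μ ≤ ν)
    (hν : ν ≤ lam) (N : ℕ) (d : ℕ →₀ ℕ) :
    {T : ReversePlanePartition lam μ //
        (T.sub (N + 1) = lam ∧ T.IsAdmissible P e d) ∧ T.sub N = ν} ≃
      {T : ReversePlanePartition ν μ //
        (P ν lam ∧ e ν lam = d N) ∧ T.sub N = ν ∧ T.IsAdmissible P e (d.erase N)} where
  toFun T := ⟨T.1.restrict hν, by
    obtain ⟨T, ⟨h1, h2⟩, h3⟩ := T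
    have hs := fun k => T.restrict_sub (k := k) (hμ.trans hν) h3 hν
    have htop : (T.restrict hν).sub N = ν := (hs N le_rfl).trans h3
    refine ⟨by simpa [h1, h3] using h2 N, htop, fun k => ?_⟩
    rcases lt_or_ge k N with hk | hk
    · rw [hs k hk.le, hs (k + 1) hk, Finsupp.erase_ne hk.ne]
      exact h2 k
    -- The restricted chain rests at ν from index N on, matching the erased value at N. Beyond N the
    -- exponents vanish because the original chain already rests at λ.
    · rw [sub_eq_top_of_le htop hk, sub_eq_top_of_le htop (by omega), (he ν ν le_rfl).2 rfl]
      refine ⟨hP ν, ?_⟩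
      rcases hk.eq_or_lt with rfl | hk
      · simp
      · rw [Finsupp.erase_ne hk.ne', ← (h2 k).2, sub_eq_top_of_le h1 hk,
          sub_eq_top_of_le h1 (by omega), (he lam lam le_rfl).2 rfl]⟩
  invFun T := ⟨T.1.extend lam N, by
    obtain ⟨T, ⟨h1, h2⟩, h3, h4⟩ := T
    have hs := fun k => T.extend_sub (k := k) (N := N) hμ hν
    have htop := T.extend_sub_succ lam N
    dsimp only
    refine ⟨⟨htop, fun k => ?_⟩, (hs N le_rfl).trans h3⟩
    rcases lt_trichotomy k N with hk | rfl | hk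
    · rw [hs k hk.le, hs (k + 1) hk, ← Finsupp.erase_ne (f := d) hk.ne]
      exact h4 k
    · rw [htop, hs k le_rfl, h3]
      exact ⟨h1, h2⟩
    · rw [sub_eq_top_of_le htop hk, sub_eq_top_of_le htop (by omega), (he lam lam le_rfl).2 rfl]
      refine ⟨hP lam, ?_⟩
      have := (h4 k).2
      rwa [Finsupp.erase_ne hk.ne', sub_eq_top_of_le h3 hk.le, sub_eq_top_of_le h3 (by omega),
        (he ν ν le_rfl).2 rfl] at this⟩
  left_inv T := Subtype.ext (extend_restrict T.1 T.2.2 hν T.2.1.1)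
  right_inv T := Subtype.ext (restrict_extend hν T.1 T.2.2.1)

end ReversePlanePartition

open ReversePlanePartition

theorem natCard_eq_sum_fiber {α β : Type*} [Finite α] (f : α → β) (s : Finset β)
    (hf : ∀ a, f a ∈ s) : Nat.card α = ∑ b ∈ s, Nat.card {a // f a = b} := by
  classical
  have := Fintype.ofFinite α
  rw [Nat.card_eq_fintype_card, ← Finset.card_univ,
    Finset.card_eq_sum_card_fiberwise (f := f) (t := s) fun a _ => hf a]
  refine Finset.sum_congr rfl fun b _ => ?_
  rw [Nat.card_eq_fintype_card, Fintype.card_subtype]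

/-- Induction on N: the last operator accounts for the boxes with entry N, and ν is the diagram left
after removing them. -/
theorem coeff_prod_transfer {K : Type*} [CommRing K] {P : YoungDiagram → YoungDiagram → Prop}
    {e : YoungDiagram → YoungDiagram → ℕ} (hP : ∀ μ, P μ μ)
    (he : ∀ μ lam, μ ≤ lam → (e μ lam = 0 ↔ μ = lam)) (N : ℕ) :
    ∀ (μ lam : YoungDiagram) (d : ℕ →₀ ℕ), μ ≤ lam →
      MvPolynomial.coeff d
        (((List.range N).map fun i => transfer P e (MvPolynomial.X i : MvPolynomial ℕ K)).prod
          μ lam) =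
        (Nat.card {T : ReversePlanePartition lam μ // T.sub N = lam ∧ T.IsAdmissible P e d} : K) := by
  classical
  induction N with
  | zero =>
    intro μ lam d hle
    simp only [List.range_zero, List.map_nil, List.prod_nil, IncidenceAlgebra.one_apply]
    by_cases h : μ = lam
    · subst h
      rw [if_pos rfl, MvPolynomial.coeff_one]
      have hsub : ∀ (T : ReversePlanePartition μ μ) k, T.sub k = μ := fun T k =>
        le_antisymm (T.sub_le k) (le_sub le_rfl T k)
      have hadm : ∀ T : ReversePlanePartition μ μ, T.IsAdmissible P e d ↔ 0 = d := by
        intro T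
        simp only [IsAdmissible, hsub, hP, true_and, (he μ μ le_rfl).2 rfl]
        exact (DFunLike.ext_iff (f := 0) (g := d)).symm
      simp only [hadm, hsub, true_and]
      split_ifs with hd
      · have : Nat.card {T : ReversePlanePartition μ μ // 0 = d} = 1 := by
          rw [Nat.card_eq_one_iff_unique]
          refine ⟨⟨fun T T' => Subtype.ext (ReversePlanePartition.ext ?_)⟩,
            ⟨⟨⟨fun _ _ => 0, fun _ _ _ => le_rfl, fun _ _ _ => le_rfl, fun _ => rfl⟩, hd⟩⟩⟩
          funext i j
          rw [T.1.zeros (by simp [skewCells_self]), T'.1.zeros (by simp [skewCells_self])]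
        rw [this, Nat.cast_one]
      · have : IsEmpty {T : ReversePlanePartition μ μ // 0 = d} := ⟨fun T => hd T.2⟩
        rw [Nat.card_of_isEmpty, Nat.cast_zero]
    · have : IsEmpty {T : ReversePlanePartition lam μ // T.sub 0 = lam ∧ T.IsAdmissible P e d} :=
        ⟨fun T => h ((sub_zero hle T.1).symm.trans T.2.1)⟩
      rw [if_neg h, Nat.card_of_isEmpty, Nat.cast_zero, MvPolynomial.coeff_zero]
  | succ N ih =>
    intro μ lam d hle
    have := finite_sub_eq lam μ (N + 1)
    have : Finite {T : ReversePlanePartition lam μ //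
        T.sub (N + 1) = lam ∧ T.IsAdmissible P e d} :=
      Finite.of_injective (fun T => (⟨T.1, T.2.1⟩ :
        {T : ReversePlanePartition lam μ // T.sub (N + 1) = lam})) fun T T' h =>
          Subtype.ext (congrArg (fun x => x.1) h)
    rw [natCard_eq_sum_fiber (fun T => T.1.sub N) (Icc μ lam)
      (fun T => Finset.mem_Icc.2 ⟨le_sub hle _ _, sub_le _ _⟩), Nat.cast_sum,
      List.range_succ, List.map_append, List.prod_append, List.map_singleton, List.prod_singleton,
      IncidenceAlgebra.mul_apply, MvPolynomial.coeff_sum]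
    refine Finset.sum_congr rfl fun ν hν => ?_
    rw [Finset.mem_Icc] at hν
    rw [Nat.card_congr (Equiv.subtypeSubtypeEquivSubtypeInter
        (fun T : ReversePlanePartition lam μ => T.sub (N + 1) = lam ∧ T.IsAdmissible P e d)
        (fun T => T.sub N = ν)),
      Nat.card_congr (removeLargest hP he hν.1 hν.2 N d)]
    by_cases hPe : P ν lam ∧ e ν lam = d N
    · rw [transfer_apply _ hν.2 hPe.1, MvPolynomial.X_pow_eq_monomial, MvPolynomial.coeff_mul_monomial',
        if_pos (by rw [hPe.2, Finsupp.single_le_iff]), mul_one, ih μ ν _ hν.1]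
      have herase : d - Finsupp.single N (e ν lam) = d.erase N := by
        ext k
        rw [Finsupp.tsub_apply, hPe.2]
        by_cases hk : k = N
        · subst hk; simp
        · rw [Finsupp.erase_ne hk, Finsupp.single_eq_of_ne hk, Nat.sub_zero]
      rw [herase]
      simp only [hPe, true_and, and_self]
    · have : IsEmpty {T : ReversePlanePartition ν μ //
          (P ν lam ∧ e ν lam = d N) ∧ T.sub N = ν ∧ T.IsAdmissible P e (d.erase N)} :=
        ⟨fun T => hPe T.2.1⟩
      rw [Nat.card_of_isEmpty, Nat.cast_zero]
      by_cases hP' : P ν lam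
      · rw [transfer_apply _ hν.2 hP', MvPolynomial.X_pow_eq_monomial, MvPolynomial.coeff_mul_monomial']
        split_ifs with hle'
        · rw [ih μ ν _ hν.1]
          -- The remaining exponent of variable N is nonzero since e ν λ ≠ d N, but chains that
          -- reach ν by index N make no further step.
          have : IsEmpty {T : ReversePlanePartition ν μ //
              T.sub N = ν ∧ T.IsAdmissible P e (d - Finsupp.single N (e ν lam) : ℕ →₀ ℕ)} := by
            refine ⟨fun T => hPe ⟨hP', ?_⟩⟩
            have h1 := (T.2.2 N).2
            rw [sub_eq_top_of_le T.2.1 le_rfl, sub_eq_top_of_le T.2.1 (Nat.le_succ N),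
              (he ν ν le_rfl).2 rfl, Finsupp.tsub_apply, Finsupp.single_eq_same] at h1
            rw [Finsupp.single_le_iff] at hle'
            omega
          rw [Nat.card_of_isEmpty, Nat.cast_zero, zero_mul]
        · rfl
      · rw [transfer_apply_of_not _ hP', mul_zero, MvPolynomial.coeff_zero]

end Chains

/-! ### Symmetry -/

section Symmetry

open ReversePlanePartition

/-- `F` is the generating function of the chains of diagrams from `μ` to `lam` whose steps are
weighted by `transfer P e`. -/
def IsChainSeries {K : Type*} [CommRing K] (P : YoungDiagram → YoungDiagram → Prop)
    (e : YoungDiagram → YoungDiagram → ℕ) (μ lam : YoungDiagram) (F : MvPowerSeries ℕ K) : Prop :=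
  ∀ d : ℕ →₀ ℕ, MvPowerSeries.coeff d F =
    (Nat.card {T : ReversePlanePartition lam μ // T.IsAdmissible P e d} : K)

variable {K : Type*} [CommRing K] {P : YoungDiagram → YoungDiagram → Prop}
  {e : YoungDiagram → YoungDiagram → ℕ} {μ lam : YoungDiagram} {F : MvPowerSeries ℕ K}

/-- The product of the operators `transfer P e x_i` over a list of variables. -/
noncomputable def prodTransfer (K : Type*) [CommRing K] (P : YoungDiagram → YoungDiagram → Prop)
    (e : YoungDiagram → YoungDiagram → ℕ) (l : List ℕ) : IA (MvPolynomial ℕ K) :=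
  (l.map fun i => transfer P e (MvPolynomial.X i)).prod

theorem IsChainSeries.coeff_prod (hF : IsChainSeries P e μ lam F) (hP : ∀ μ, P μ μ)
    (he : ∀ μ lam, μ ≤ lam → (e μ lam = 0 ↔ μ = lam)) (hle : μ ≤ lam) {N : ℕ} {d : ℕ →₀ ℕ}
    (hd : ∀ k, N ≤ k → d k = 0) :
    MvPolynomial.coeff d (prodTransfer K P e (List.range N) μ lam) = MvPowerSeries.coeff d F := by
  rw [prodTransfer, coeff_prod_transfer hP he N μ lam d hle, hF]
  congr 1
  refine Nat.card_congr (Equiv.subtypeEquivRight fun T => and_iff_right_of_imp fun hT => ?_)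
  exact sub_eq_of_isAdmissible he hd hT

theorem coeff_prodTransfer_eq_zero (hP : ∀ μ, P μ μ)
    (he : ∀ μ lam, μ ≤ lam → (e μ lam = 0 ↔ μ = lam)) (hle : μ ≤ lam) {N k : ℕ} {d : ℕ →₀ ℕ}
    (hk : N ≤ k) (hd : d k ≠ 0) :
    MvPolynomial.coeff d (prodTransfer K P e (List.range N) μ lam) = 0 := by
  rw [prodTransfer, coeff_prod_transfer hP he N μ lam d hle]
  have : IsEmpty {T : ReversePlanePartition lam μ // T.sub N = lam ∧ T.IsAdmissible P e d} := by
    refine ⟨fun T => hd ?_⟩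
    rw [← (T.2.2 k).2, sub_eq_top_of_le T.2.1 hk, sub_eq_top_of_le T.2.1 (by omega),
      (he lam lam le_rfl).2 rfl]
  rw [Nat.card_of_isEmpty, Nat.cast_zero]

theorem exists_bound (d : ℕ →₀ ℕ) : ∃ N, ∀ k, N ≤ k → d k = 0 := by
  refine ⟨d.support.sup id + 1, fun k hk => ?_⟩
  by_contra h
  have := Finset.le_sup (f := id) (Finsupp.mem_support_iff.2 h)
  simp only [id_eq] at this
  omega

open Classical in
/-- Setting to zero the variables in `s`. -/
noncomputable def killVars (K : Type*) [CommRing K] (s : Set ℕ) :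
    MvPolynomial ℕ K →ₐ[K] MvPolynomial ℕ K :=
  MvPolynomial.aeval fun j => if j ∈ s then 0 else MvPolynomial.X j

theorem coeff_killVars {s : Set ℕ} {d : ℕ →₀ ℕ} (hd : ∀ k ∈ s, d k = 0) (p : MvPolynomial ℕ K) :
    MvPolynomial.coeff d (killVars K s p) = MvPolynomial.coeff d p := by
  classical
  induction p using MvPolynomial.induction_on' with
  | monomial u a =>
    rw [killVars, MvPolynomial.aeval_monomial]
    by_cases hu : ∀ k ∈ s, u k = 0
    · have : (u.prod fun i k => (if i ∈ s then (0 : MvPolynomial ℕ K) else MvPolynomial.X i) ^ k) =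
          u.prod fun i k => (MvPolynomial.X i : MvPolynomial ℕ K) ^ k := by
        refine Finset.prod_congr rfl fun i hi => ?_
        have : i ∉ s := fun h => Finsupp.mem_support_iff.1 hi (hu i h)
        simp only [if_neg this]
      rw [this, MvPolynomial.monomial_eq]
      rfl
    · push Not at hu
      obtain ⟨k, hk, hk'⟩ := hu
      have : (u.prod fun i k => (if i ∈ s then (0 : MvPolynomial ℕ K) else MvPolynomial.X i) ^ k) =
          0 := by
        refine Finset.prod_eq_zero (Finsupp.mem_support_iff.2 hk') ?_
        simp only [if_pos hk, zero_pow hk']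
      rw [this, mul_zero, MvPolynomial.coeff_zero, MvPolynomial.coeff_monomial, if_neg]
      rintro rfl
      exact hk' (hd k hk)
  | add p q hp hq => rw [map_add, MvPolynomial.coeff_add, MvPolynomial.coeff_add, hp, hq]

theorem iaMap_prodTransfer {S : Type*} [CommRing S] (φ : MvPolynomial ℕ K →+* S) (l : List ℕ) :
    iaMap φ (prodTransfer K P e l) =
      (l.map fun i => transfer P e (φ (MvPolynomial.X i))).prod := by
  rw [prodTransfer, map_list_prod, List.map_map]
  congr 1
  refine List.map_congr_left fun i _ => ?_
  rw [Function.comp_apply, iaMap_transfer]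

/-- The lists differ by order, which commutation absorbs, and by indices at which d vanishes.
Setting those variables to zero preserves the coefficient and turns their operators into 1. -/
theorem coeff_prodTransfer_map_perm (hP : ∀ μ, P μ μ)
    (he : ∀ μ lam, μ ≤ lam → (e μ lam = 0 ↔ μ = lam))
    (hcomm : ∀ x y : MvPolynomial ℕ K, Commute (transfer P e x) (transfer P e y))
    (σ : Equiv.Perm ℕ) {N M : ℕ} (hM : ∀ i < N, σ i < M) {d : ℕ →₀ ℕ}
    (hd : ∀ k, N ≤ k → d (σ k) = 0) (μ lam : YoungDiagram) :
    MvPolynomial.coeff d (prodTransfer K P e ((List.range N).map σ) μ lam) =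
      MvPolynomial.coeff d (prodTransfer K P e (List.range M) μ lam) := by
  classical
  set rest := (List.range M).filter fun j => j ∉ (List.range N).map σ with hrest
  have hperm : (List.range M).Perm ((List.range N).map σ ++ rest) := by
    refine (List.perm_ext_iff_of_nodup List.nodup_range ?_).2 fun j => ?_
    · refine List.Nodup.append (List.nodup_range.map σ.injective)
        (List.nodup_range.filter _) fun j h1 h2 => ?_
      rw [hrest, List.mem_filter] at h2
      simp [h1] at h2
    · rw [List.mem_append, hrest, List.mem_filter]
      by_cases hj : j ∈ (List.range N).map σ
      · simp only [hj, true_or, iff_true]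
        obtain ⟨i, hi, rfl⟩ := List.mem_map.1 hj
        exact List.mem_range.2 (hM i (List.mem_range.1 hi))
      · simp [hj]
  have hd' : ∀ k ∈ {j | j ∈ rest}, d k = 0 := by
    intro k hk
    obtain ⟨m, rfl⟩ := σ.surjective k
    refine hd m ?_
    by_contra hlt
    have := (List.mem_filter.1 hk).2
    simp only [decide_eq_true_eq] at this
    exact this (List.mem_map.2 ⟨m, List.mem_range.2 (by omega), rfl⟩)
  rw [← coeff_killVars hd', ← coeff_killVars hd' (prodTransfer K P e (List.range M) μ lam)]
  congr 1
  change iaMap (killVars K {j | j ∈ rest}).toRingHom _ μ lam =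
    iaMap (killVars K {j | j ∈ rest}).toRingHom _ μ lam
  rw [iaMap_prodTransfer, iaMap_prodTransfer,
    (hperm.map _).prod_eq' (List.pairwise_map.2 (List.pairwise_of_forall fun _ _ => hcomm _ _)),
    List.map_append, List.prod_append, List.prod_eq_one (l := rest.map _), mul_one]
  intro x hx
  obtain ⟨j, hj, rfl⟩ := List.mem_map.1 hx
  have : (killVars K {j | j ∈ rest}).toRingHom (MvPolynomial.X j) = 0 := by
    change killVars K {j | j ∈ rest} (MvPolynomial.X j) = 0
    rw [killVars, MvPolynomial.aeval_X, if_pos (show j ∈ {j | j ∈ rest} from hj)]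
  rw [this, transfer_zero hP he]

theorem IsChainSeries.mem_symSeries (hF : IsChainSeries P e μ lam F) (hP : ∀ μ, P μ μ)
    (he : ∀ μ lam, μ ≤ lam → (e μ lam = 0 ↔ μ = lam)) (hle : μ ≤ lam)
    (hcomm : ∀ x y : MvPolynomial ℕ K, Commute (transfer P e x) (transfer P e y)) :
    F ∈ SymSeries K := by
  intro σ
  ext x
  obtain ⟨d, rfl⟩ : ∃ d, Finsupp.embDomain σ.toEmbedding d = x :=
    ⟨Finsupp.embDomain σ.symm.toEmbedding x, by
      ext k
      obtain ⟨m, rfl⟩ := σ.surjective k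
      have h1 := Finsupp.embDomain_apply_self σ.toEmbedding
        (Finsupp.embDomain σ.symm.toEmbedding x) m
      have h2 := Finsupp.embDomain_apply_self σ.symm.toEmbedding x (σ m)
      simp only [Equiv.coe_toEmbedding, Equiv.symm_apply_apply] at h1 h2
      rw [h1, h2]⟩
  refine (MvPowerSeries.coeff_embDomain_rename σ.toEmbedding F d).trans ?_
  obtain ⟨N, hN⟩ := exists_bound d
  obtain ⟨M, hM⟩ : ∃ M, ∀ i < N, σ i < M :=
    ⟨(range N).sup σ + 1, fun i hi => Nat.lt_succ_of_le (Finset.le_sup (Finset.mem_range.2 hi))⟩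
  have hself : ∀ m, Finsupp.embDomain σ.toEmbedding d (σ m) = d m := fun m =>
    Finsupp.embDomain_apply_self σ.toEmbedding d m
  have hd : ∀ k, N ≤ k → Finsupp.embDomain σ.toEmbedding d (σ k) = 0 := fun k hk => by
    rw [hself, hN k hk]
  have hd' : ∀ k, M ≤ k → Finsupp.embDomain σ.toEmbedding d k = 0 := by
    intro k hk
    obtain ⟨m, rfl⟩ := σ.surjective k
    refine hd m ?_
    by_contra hlt
    have := hM m (by omega)
    omega
  rw [← hF.coeff_prod hP he hle hN, ← hF.coeff_prod hP he hle hd',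
    ← coeff_prodTransfer_map_perm hP he hcomm σ hM hd]
  have : prodTransfer K P e ((List.range N).map σ) μ lam =
      MvPolynomial.rename σ (prodTransfer K P e (List.range N) μ lam) := by
    change _ = iaMap (MvPolynomial.rename σ : MvPolynomial ℕ K →ₐ[K] _).toRingHom _ μ lam
    rw [iaMap_prodTransfer, prodTransfer, List.map_map]
    refine congrArg (fun l : List (IA (MvPolynomial ℕ K)) => l.prod μ lam)
      (List.map_congr_left fun i _ => ?_)
    rw [Function.comp_apply]
    exact congrArg (transfer P e) (MvPolynomial.rename_X σ i).symm
  rw [this, Finsupp.embDomain_eq_mapDomain]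
  exact (MvPolynomial.coeff_rename_mapDomain σ σ.injective _ _).symm

theorem IsChainSeries.exists_of_coeff_ne_zero (hF : IsChainSeries P e μ lam F) {d : ℕ →₀ ℕ}
    (h : MvPowerSeries.coeff d F ≠ 0) : ∃ T : ReversePlanePartition lam μ, T.IsAdmissible P e d := by
  by_contra hc
  have : IsEmpty {T : ReversePlanePartition lam μ // T.IsAdmissible P e d} :=
    ⟨fun T => hc ⟨T.1, T.2⟩⟩
  rw [hF, Nat.card_of_isEmpty, Nat.cast_zero] at h
  exact h rfl

theorem degree_eq_sum_range {d : ℕ →₀ ℕ} {N : ℕ} (hN : ∀ k, N ≤ k → d k = 0) :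
    d.degree = ∑ k ∈ range N, d k := by
  rw [Finsupp.degree_apply]
  refine Finset.sum_subset (fun k hk => ?_) fun k _ hk => by simpa using hk
  rw [Finset.mem_range]
  by_contra hlt
  exact Finsupp.mem_support_iff.1 hk (hN k (by omega))

theorem ReversePlanePartition.sum_card_skewCells (T : ReversePlanePartition lam μ) (hle : μ ≤ lam)
    (N : ℕ) : μ.card + ∑ k ∈ range N, (skewCells (T.sub (k + 1)) (T.sub k)).card =
      (T.sub N).card := by
  induction N with
  | zero => simp [sub_zero hle]
  | succ N ih =>
    rw [Finset.sum_range_succ, ← add_assoc, ih, card_skewCells (T.sub_mono (Nat.le_add_right N 1))]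
    have := Finset.card_le_card (YoungDiagram.cells_subset_iff.2 (T.sub_mono (Nat.le_add_right N 1)))
    simp only [YoungDiagram.card] at *
    omega

theorem numCols_le (lam μ : YoungDiagram) : numCols lam μ ≤ (skewCells lam μ).card :=
  Finset.card_image_le

theorem isChainSeries_dualGroth (K : Type*) [CommRing K] (lam μ : YoungDiagram) :
    IsChainSeries (fun _ _ => True) (fun μ lam => numCols lam μ) μ lam (dualGroth K lam μ) := by
  intro d
  change (Nat.card _ : K) = _
  congr 1
  refine Nat.card_congr (Equiv.subtypeEquivRight fun T => forall_congr' fun k => ?_)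
  dsimp only
  rw [true_and, numCols, T.skewCells_sub_succ, colCount]

theorem dualGroth_mem (K : Type*) [CommRing K] {lam μ : YoungDiagram} (hle : μ ≤ lam) :
    dualGroth K lam μ ∈ SymFun K := by
  refine ⟨(isChainSeries_dualGroth K lam μ).mem_symSeries (fun _ => trivial)
    (fun _ _ h => numCols_eq_zero_iff h) hle colOp_commute, lam.card, fun d hd => ?_⟩
  by_contra hc
  obtain ⟨T, hT⟩ := (isChainSeries_dualGroth K lam μ).exists_of_coeff_ne_zero hc
  obtain ⟨N, hN⟩ := exists_bound d
  rw [degree_eq_sum_range hN] at hd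
  have h1 : ∑ k ∈ range N, d k ≤ ∑ k ∈ range N, (skewCells (T.sub (k + 1)) (T.sub k)).card :=
    Finset.sum_le_sum fun k _ => by
      rw [← (hT k).2]
      exact numCols_le _ _
  have h2 := T.sum_card_skewCells hle N
  have h3 := Finset.card_le_card (YoungDiagram.cells_subset_iff.2 (T.sub_le N))
  simp only [YoungDiagram.card] at *
  omega

/-! ### Semistandard tableaux as chains of horizontal strips -/

theorem interlacing_rowLen_iff {lam μ : YoungDiagram} :
    Interlacing YoungDiagram.rowLen μ lam ↔
      ∀ i i' j, (i, j) ∈ skewCells lam μ → (i', j) ∈ skewCells lam μ → ¬ i < i' := by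
  constructor
  · intro h i i' j h1 h2 hlt
    have h1 := (mem_skewCells_iff_rowLen.1 h1).2
    have h2 := (mem_skewCells_iff_rowLen.1 h2).1
    have h3 := lam.rowLen_anti (i + 1) i' hlt
    have h4 := h i
    dsimp only at h1 h2
    omega
  · intro h i
    by_contra! hlt
    have h1 := lam.rowLen_anti i (i + 1) (Nat.le_succ i)
    have h2 := μ.rowLen_anti i (i + 1) (Nat.le_succ i)
    exact h i (i + 1) (μ.rowLen i) (mem_skewCells_iff_rowLen.2 ⟨by dsimp only; omega, le_rfl⟩)
      (mem_skewCells_iff_rowLen.2 ⟨hlt, h2⟩) (Nat.lt_succ_self i)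

theorem skewCells_bot (lam : YoungDiagram) : skewCells lam ⊥ = lam.cells := by simp [skewCells]

theorem mem_skewCells_bot {lam : YoungDiagram} {c : ℕ × ℕ} : c ∈ skewCells lam ⊥ ↔ c ∈ lam := by
  rw [skewCells_bot, YoungDiagram.mem_cells]

/-- A semistandard tableau as a reverse plane partition. -/
def toReversePlanePartition {lam : YoungDiagram} (T : SemistandardYoungTableau lam) :
    ReversePlanePartition lam ⊥ where
  entry := T
  row_weak hj _ h2 := T.row_weak hj (mem_skewCells_bot.1 h2)
  col_weak hi _ h2 := (T.col_strict hi (mem_skewCells_bot.1 h2)).le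
  zeros h := T.zeros fun h' => h (mem_skewCells_bot.2 h')

theorem card_skewCells_sub_succ {lam : YoungDiagram} (T : ReversePlanePartition lam ⊥) (k : ℕ) :
    (skewCells (T.sub (k + 1)) (T.sub k)).card =
      (lam.cells.filter fun c => T.entry c.1 c.2 = k).card := by
  rw [T.skewCells_sub_succ, skewCells_bot]

/-- Semistandard tableaux as chains of horizontal strips. -/
def tableauEquiv (lam : YoungDiagram) (d : ℕ → ℕ) :
    {T : SemistandardYoungTableau lam //
        ∀ k, (lam.cells.filter fun c => T c.1 c.2 = k).card = d k} ≃
      {T : ReversePlanePartition lam ⊥ // T.IsAdmissible (Interlacing YoungDiagram.rowLen)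
        (fun μ lam => (skewCells lam μ).card) d} where
  toFun T := ⟨toReversePlanePartition T.1, fun k => by
    refine ⟨interlacing_rowLen_iff.2 fun i i' j h1 h2 hlt => ?_, ?_⟩
    · rw [skewCells_sub_succ, Finset.mem_filter] at h1 h2
      have := T.1.col_strict hlt (mem_skewCells_bot.1 h2.1)
      exact this.ne (h1.2.trans h2.2.symm)
    · exact (card_skewCells_sub_succ _ k).trans (T.2 k)⟩
  invFun T := ⟨⟨T.1.entry, fun {i j1 j2} hj h2 => T.1.row_weak hj
      (mem_skewCells_bot.2 (lam.up_left_mem le_rfl hj.le h2)) (mem_skewCells_bot.2 h2),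
      fun {i1 i2 j} hi h2 => by
        have h1 := lam.up_left_mem hi.le le_rfl h2
        refine lt_of_le_of_ne (T.1.col_weak hi (mem_skewCells_bot.2 h1) (mem_skewCells_bot.2 h2))
          fun heq => ?_
        -- Equal entries in one column would put two boxes of that column into a single horizontal
        -- strip.
        refine interlacing_rowLen_iff.1 (T.2 (T.1.entry i1 j)).1 i1 i2 j ?_ ?_ hi
        · rw [skewCells_sub_succ, Finset.mem_filter]
          exact ⟨mem_skewCells_bot.2 h1, rfl⟩
        · rw [skewCells_sub_succ, Finset.mem_filter]
          exact ⟨mem_skewCells_bot.2 h2, heq.symm⟩,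
      fun {i j} h => T.1.zeros fun h' => h (mem_skewCells_bot.1 h')⟩, fun k => by
    exact (card_skewCells_sub_succ T.1 k).symm.trans (T.2 k).2⟩
  left_inv _ := rfl
  right_inv _ := rfl

theorem isChainSeries_schur (K : Type*) [CommRing K] (lam : YoungDiagram) :
    IsChainSeries (Interlacing YoungDiagram.rowLen) (fun μ lam => (skewCells lam μ).card) ⊥ lam
      (schur K lam) := fun d => by
  change (Nat.card _ : K) = _
  rw [Nat.card_congr (tableauEquiv lam d)]

theorem schur_mem_symSeries (K : Type*) [CommRing K] (lam : YoungDiagram) :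
    schur K lam ∈ SymSeries K :=
  (isChainSeries_schur K lam).mem_symSeries interlacing_rowLen_self
    (fun _ _ h => card_skewCells_eq_zero_iff h) bot_le horizOp_commute

theorem coeff_schur_eq_zero {lam : YoungDiagram} {d : ℕ →₀ ℕ} (h : d.degree ≠ lam.card) :
    MvPowerSeries.coeff d (schur K lam) = 0 := by
  by_contra hc
  obtain ⟨T, hT⟩ := (isChainSeries_schur K lam).exists_of_coeff_ne_zero hc
  obtain ⟨N, hN⟩ := exists_bound d
  refine h ?_
  rw [degree_eq_sum_range hN, ← sub_eq_of_isAdmissible (fun _ _ h => card_skewCells_eq_zero_iff h)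
    hN hT, ← T.sum_card_skewCells bot_le N]
  simp only [YoungDiagram.card, YoungDiagram.cells_bot, Finset.card_empty, zero_add]
  exact Finset.sum_congr rfl fun k _ => (hT k).2.symm

end Symmetry

/-! ### Expansion into Schur functions -/

section SchurExpansion

open ReversePlanePartition

/-- The row lengths of a Young diagram as an exponent vector. -/
noncomputable def rowExp (μ : YoungDiagram) : ℕ →₀ ℕ :=
  Finsupp.onFinset (range μ.card) μ.rowLen fun i hi => by
    rw [Finset.mem_range]
    by_contra hlt
    exact hi (rowLen_eq_zero (not_lt.1 hlt))

@[simp] theorem rowExp_apply (μ : YoungDiagram) (i : ℕ) : rowExp μ i = μ.rowLen i := rfl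

theorem rowLen_bot (i : ℕ) : (⊥ : YoungDiagram).rowLen i = 0 :=
  rowLen_eq_zero (lam := ⊥) (Nat.zero_le i)

theorem card_eq_sum_rowLen (μ : YoungDiagram) {N : ℕ} (hN : ∀ i, N ≤ i → μ.rowLen i = 0) :
    μ.card = ∑ i ∈ range N, μ.rowLen i := by
  have h := card_skewCells_eq_sum_rowLen (lam := μ) (μ := ⊥)
  simp only [skewCells_bot, rowLen_bot, Nat.sub_zero] at h
  exact (h.trans (degree_eq_sum_range (d := rowExp μ) fun k hk => rowLen_eq_zero hk).symm).trans
    (degree_eq_sum_range (d := rowExp μ) hN)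

theorem degree_rowExp (μ : YoungDiagram) : (rowExp μ).degree = μ.card := by
  rw [card_eq_sum_rowLen μ (fun k hk => rowLen_eq_zero hk)]
  exact degree_eq_sum_range fun k hk => rowLen_eq_zero hk

/-- The chains of diagrams counted by Kostka numbers. -/
abbrev IsHorizontalChain {lam : YoungDiagram} (T : ReversePlanePartition lam ⊥) (d : ℕ → ℕ) : Prop :=
  T.IsAdmissible (Interlacing YoungDiagram.rowLen) (fun μ lam => (skewCells lam μ).card) d

/-- Adding a horizontal strip creates at most one new row. -/
theorem rowLen_sub_eq_zero {lam : YoungDiagram} {T : ReversePlanePartition lam ⊥} {d : ℕ → ℕ}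
    (hT : IsHorizontalChain T d) (k i : ℕ) (hi : k ≤ i) : (T.sub k).rowLen i = 0 := by
  have key : (T.sub k).rowLen k = 0 := by
    induction k generalizing i with
    | zero => rw [sub_zero bot_le, rowLen_bot]
    | succ k ih =>
      have := (hT k).1 k
      rw [ih k le_rfl] at this
      exact Nat.le_zero.1 this
  have := (T.sub k).rowLen_anti k i hi
  omega

theorem card_sub_eq_sum {lam : YoungDiagram} {T : ReversePlanePartition lam ⊥} {d : ℕ → ℕ}
    (hT : IsHorizontalChain T d) (k : ℕ) : (T.sub k).card = ∑ i ∈ range k, d i := by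
  rw [← T.sum_card_skewCells bot_le k]
  simp only [YoungDiagram.card, YoungDiagram.cells_bot, Finset.card_empty, zero_add]
  exact Finset.sum_congr rfl fun i _ => (hT i).2

/-- Dominance: the boxes with entry less than k all lie in the first k rows. -/
theorem sum_le_sum_rowLen {lam : YoungDiagram} {T : ReversePlanePartition lam ⊥} {d : ℕ → ℕ}
    (hT : IsHorizontalChain T d) (k : ℕ) :
    ∑ i ∈ range k, d i ≤ ∑ i ∈ range k, lam.rowLen i := by
  rw [← card_sub_eq_sum hT, card_eq_sum_rowLen _ (rowLen_sub_eq_zero hT k)]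
  exact Finset.sum_le_sum fun i _ => le_iff_rowLen.1 (T.sub_le k) i

/-- Equality in the dominance inequalities forces the entries less than k to fill the first k rows
completely. -/
theorem entry_eq_of_rowLen {lam : YoungDiagram} {T : ReversePlanePartition lam ⊥}
    (hT : IsHorizontalChain T lam.rowLen) {i j : ℕ} (hc : (i, j) ∈ lam) : T.entry i j = i := by
  have key : ∀ k i, i < k → (T.sub k).rowLen i = lam.rowLen i := by
    intro k i hi
    have h := card_sub_eq_sum hT k
    rw [card_eq_sum_rowLen _ (rowLen_sub_eq_zero hT k),
      Finset.sum_eq_sum_iff_of_le fun i _ => le_iff_rowLen.1 (T.sub_le k) i] at h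
    exact h i (Finset.mem_range.2 hi)
  have h1 : (i, j) ∈ T.sub (i + 1) := by
    rw [YoungDiagram.mem_iff_lt_rowLen, key _ _ (Nat.lt_succ_self i)]
    exact YoungDiagram.mem_iff_lt_rowLen.1 hc
  have h2 : (i, j) ∉ T.sub i := by
    rw [YoungDiagram.mem_iff_lt_rowLen, rowLen_sub_eq_zero hT i i le_rfl]
    exact Nat.not_lt_zero _
  have h3 := (mem_sub.1 h1).2.resolve_left (YoungDiagram.notMem_bot _)
  have h4 : ¬ T.entry i j < i := fun h => h2 (mem_sub.2 ⟨hc, Or.inr h⟩)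
  dsimp only at h3
  omega

variable {K : Type*} [CommRing K]

theorem coeff_rowExp_schur_self (lam : YoungDiagram) :
    MvPowerSeries.coeff (rowExp lam) (schur K lam) = 1 := by
  rw [isChainSeries_schur K lam]
  have : Nat.card {T : ReversePlanePartition lam ⊥ // IsHorizontalChain T (rowExp lam)} = 1 := by
    rw [Nat.card_eq_one_iff_unique]
    refine ⟨⟨fun T T' => Subtype.ext (ReversePlanePartition.ext ?_)⟩,
      ⟨tableauEquiv lam _ ⟨SemistandardYoungTableau.highestWeight lam, fun k => ?_⟩⟩⟩
    · funext i j
      by_cases hc : (i, j) ∈ lam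
      · rw [entry_eq_of_rowLen T.2 hc, entry_eq_of_rowLen T'.2 hc]
      · rw [T.1.zeros (fun h => hc (mem_skewCells_bot.1 h)),
          T'.1.zeros (fun h => hc (mem_skewCells_bot.1 h))]
    · rw [rowExp_apply, YoungDiagram.rowLen_eq_card]
      refine congrArg Finset.card (Finset.filter_congr fun c hc => ?_)
      rw [SemistandardYoungTableau.highestWeight_apply,
        if_pos ((YoungDiagram.mem_cells _).1 hc)]
  rw [this, Nat.cast_one]

theorem dominance_of_coeff_ne_zero {μ lam : YoungDiagram}
    (h : MvPowerSeries.coeff (rowExp μ) (schur K lam) ≠ 0) (k : ℕ) :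
    ∑ i ∈ range k, μ.rowLen i ≤ ∑ i ∈ range k, lam.rowLen i := by
  obtain ⟨T, hT⟩ := (isChainSeries_schur K lam).exists_of_coeff_ne_zero h
  exact sum_le_sum_rowLen hT k

theorem lex_lt_of_dominance {a b : ℕ → ℕ}
    (h : ∀ k, ∑ i ∈ range k, a i ≤ ∑ i ∈ range k, b i) (hab : a ≠ b) : toLex a < toLex b := by
  have hex : ∃ i, a i ≠ b i := Function.ne_iff.1 hab
  have h1 := Nat.find_spec hex
  have h2 : ∀ j, j < Nat.find hex → a j = b j := fun j hj => by simpa using Nat.find_min hex hj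
  generalize Nat.find hex = i at h1 h2
  refine ⟨i, h2, lt_of_le_of_ne ?_ h1⟩
  have h3 := h (i + 1)
  rw [Finset.sum_range_succ, Finset.sum_range_succ,
    Finset.sum_congr rfl fun j hj => h2 j (Finset.mem_range.1 hj)] at h3
  exact Nat.le_of_add_le_add_left h3

theorem det_eq_one_of_unitriangular {m L : Type*} [Fintype m] [DecidableEq m] [LinearOrder L]
    (M : Matrix m m K) (b : m → L) (hb : Function.Injective b)
    (h : ∀ i j, M i j ≠ 0 → b i ≤ b j) (hd : ∀ i, M i i = 1) : M.det = 1 := by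
  let _ : LinearOrder m := LinearOrder.lift' b hb
  rw [Matrix.det_of_isUpperTriangular, Finset.prod_eq_one fun i _ => hd i]
  intro i j hij
  by_contra hne
  exact absurd (h i j hne) (not_le.2 hij)

theorem finite_card_eq (n : ℕ) : {lam : YoungDiagram | lam.card = n}.Finite := by
  refine Set.Finite.of_finite_image (f := YoungDiagram.cells)
    ((range n ×ˢ range n).powerset.finite_toSet.subset ?_) (fun a _ b _ h => YoungDiagram.ext h)
  rintro _ ⟨lam, rfl, rfl⟩
  rw [Finset.mem_coe, Finset.mem_powerset]
  rintro ⟨i, j⟩ hc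
  rw [YoungDiagram.mem_cells] at hc
  rw [Finset.mem_product, Finset.mem_range, Finset.mem_range]
  constructor
  · by_contra hlt
    have := YoungDiagram.mem_iff_lt_rowLen.1 hc
    rw [rowLen_eq_zero (not_lt.1 hlt)] at this
    omega
  · by_contra hlt
    have := YoungDiagram.mem_iff_lt_colLen.1 hc
    rw [colLen_eq_zero (not_lt.1 hlt)] at this
    omega

/-- The Young diagrams with `n` boxes. -/
noncomputable def diagrams (n : ℕ) : Finset YoungDiagram := (finite_card_eq n).toFinset

@[simp] theorem mem_diagrams {n : ℕ} {lam : YoungDiagram} : lam ∈ diagrams n ↔ lam.card = n := by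
  simp [diagrams]

/-- The Kostka matrix in degree `n`. -/
noncomputable def kostka (K : Type*) [CommRing K] (n : ℕ) :
    Matrix (diagrams n) (diagrams n) K :=
  fun μ lam => MvPowerSeries.coeff (rowExp μ.1) (schur K lam.1)

/-- Dominance order refines to the lexicographic order of row lengths, in which the Kostka matrix is
unitriangular; hence it is invertible over every K. -/
theorem isUnit_det_kostka (n : ℕ) : IsUnit (kostka K n).det := by
  rw [det_eq_one_of_unitriangular (kostka K n) (fun lam => toLex lam.1.rowLen)]
  · exact isUnit_one
  · intro a b h
    exact Subtype.ext (isLength_rowLen.ext fun i => congrFun (toLex_inj.1 h) i)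
  · intro i j h
    by_cases hij : i.1.rowLen = j.1.rowLen
    · exact (congrArg toLex hij).le
    · exact (lex_lt_of_dominance (dominance_of_coeff_ne_zero h) hij).le
  · intro i
    exact coeff_rowExp_schur_self i.1

theorem coeff_embDomain_of_mem {F : MvPowerSeries ℕ K} (hF : F ∈ SymSeries K) (σ : Equiv.Perm ℕ)
    (d : ℕ →₀ ℕ) : MvPowerSeries.coeff (Finsupp.embDomain σ.toEmbedding d) F =
      MvPowerSeries.coeff d F := by
  conv_lhs => rw [← hF σ]
  exact MvPowerSeries.coeff_embDomain_rename σ.toEmbedding F d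

/-- Every exponent vector is a permutation of the row lengths of a Young diagram. -/
theorem exists_embDomain_rowExp (d : ℕ →₀ ℕ) :
    ∃ (σ : Equiv.Perm ℕ) (μ : YoungDiagram), Finsupp.embDomain σ.toEmbedding (rowExp μ) = d := by
  obtain ⟨N, hN⟩ := exists_bound d
  -- The order dual makes the sorted exponents weakly decreasing.
  let f : Fin N → ℕᵒᵈ := fun i => OrderDual.toDual (d i)
  let σ : Equiv.Perm ℕ := (Tuple.sort f).viaEmbedding Fin.valEmbedding
  have h1 : ∀ i : Fin N, σ i = Tuple.sort f i := fun i =>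
    Equiv.Perm.viaEmbedding_apply (Tuple.sort f) Fin.valEmbedding i
  have h2 : ∀ i, N ≤ i → σ i = i := fun i hi =>
    Equiv.Perm.viaEmbedding_apply_of_notMem (Tuple.sort f) Fin.valEmbedding i (by
      rintro ⟨k, rfl⟩
      exact absurd k.2 (not_lt.2 hi))
  have hg0 : ∀ i, N ≤ i → d (σ i) = 0 := fun i hi => by rw [h2 i hi, hN i hi]
  have hanti : Antitone fun i => d (σ i) := by
    intro i j hij
    rcases lt_or_ge j N with hj | hj
    · have := Tuple.monotone_sort f (a := ⟨i, hij.trans_lt hj⟩) (b := ⟨j, hj⟩) hij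
      simp only [f, Function.comp_apply, OrderDual.toDual_le_toDual] at this
      rw [← h1, ← h1] at this
      exact this
    · simp only [hg0 j hj, Nat.zero_le]
  obtain ⟨μ, hμ⟩ := isLength_rowLen.surj hanti hg0
  refine ⟨σ, μ, ?_⟩
  ext k
  obtain ⟨m, rfl⟩ := σ.surjective k
  exact (Finsupp.embDomain_apply_self σ.toEmbedding (rowExp μ) m).trans (hμ m)

theorem degree_embDomain (σ : Equiv.Perm ℕ) (d : ℕ →₀ ℕ) :
    (Finsupp.embDomain σ.toEmbedding d).degree = d.degree := by
  rw [Finsupp.degree_apply, Finsupp.degree_apply, Finsupp.support_embDomain, Finset.sum_map]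
  exact Finset.sum_congr rfl fun x _ => Finsupp.embDomain_apply_self _ _ _

theorem finsum_mul_coeff_schur (A : YoungDiagram → K) (d : ℕ →₀ ℕ) :
    ∑ᶠ lam : YoungDiagram, A lam * MvPowerSeries.coeff d (schur K lam) =
      ∑ lam ∈ diagrams d.degree, A lam * MvPowerSeries.coeff d (schur K lam) := by
  refine finsum_eq_sum_of_support_subset _ fun lam h => ?_
  rw [Finset.mem_coe, mem_diagrams]
  by_contra hne
  exact h (by simp only [coeff_schur_eq_zero (Ne.symm hne), mul_zero])

/-- For a symmetric series, an expansion into Schur functions need only be checked on the monomials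
with weakly decreasing exponents. -/
theorem isSchurExpansion_iff {F : MvPowerSeries ℕ K} (hF : F ∈ SymSeries K) {A : YoungDiagram → K} :
    IsSchurExpansion F A ↔ ∀ μ : YoungDiagram,
      ∑ lam ∈ diagrams μ.card, A lam * MvPowerSeries.coeff (rowExp μ) (schur K lam) =
        MvPowerSeries.coeff (rowExp μ) F := by
  constructor
  · intro h μ
    rw [h, finsum_mul_coeff_schur, degree_rowExp]
  · intro h d
    obtain ⟨σ, μ, rfl⟩ := exists_embDomain_rowExp d
    rw [coeff_embDomain_of_mem hF, ← h, finsum_mul_coeff_schur, degree_embDomain, degree_rowExp]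
    refine Finset.sum_congr rfl fun lam _ => ?_
    rw [coeff_embDomain_of_mem (schur_mem_symSeries K lam)]

theorem kostka_mulVec (A : YoungDiagram → K) {n : ℕ} (μ : diagrams n) :
    (kostka K n).mulVec (fun lam => A lam.1) μ =
      ∑ lam ∈ diagrams n, A lam * MvPowerSeries.coeff (rowExp μ.1) (schur K lam) := by
  rw [← Finset.sum_coe_sort]
  exact Finset.sum_congr rfl fun lam _ => mul_comm _ _

theorem exists_isSchurExpansion {F : MvPowerSeries ℕ K} (hF : F ∈ SymSeries K) :
    ∃ A, IsSchurExpansion F A := by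
  refine ⟨fun lam => (kostka K lam.card)⁻¹.mulVec
    (fun μ => MvPowerSeries.coeff (rowExp μ.1) F) ⟨lam, mem_diagrams.2 rfl⟩,
    (isSchurExpansion_iff hF).2 fun μ => ?_⟩
  -- The matrix used for `lam` is indexed by `lam.card`, which equals `μ.card` only propositionally;
  -- this transports all of them to one size.
  have hA : (fun lam : diagrams μ.card => (kostka K lam.1.card)⁻¹.mulVec
      (fun μ => MvPowerSeries.coeff (rowExp μ.1) F) ⟨lam.1, mem_diagrams.2 rfl⟩) =
      (kostka K μ.card)⁻¹.mulVec fun μ => MvPowerSeries.coeff (rowExp μ.1) F := by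
    funext ⟨lam, hlam⟩
    have := mem_diagrams.1 hlam
    generalize μ.card = n at hlam this
    subst this
    rfl
  have h := kostka_mulVec (K := K) (fun lam => (kostka K lam.card)⁻¹.mulVec
    (fun μ => MvPowerSeries.coeff (rowExp μ.1) F) ⟨lam, mem_diagrams.2 rfl⟩)
    (⟨μ, mem_diagrams.2 rfl⟩ : diagrams μ.card)
  rw [← h]
  rw [hA, Matrix.mulVec_mulVec, Matrix.mul_nonsing_inv _ (isUnit_det_kostka _), Matrix.one_mulVec]

theorem isSchurExpansion_unique {F : MvPowerSeries ℕ K} {A B : YoungDiagram → K}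
    (hA : IsSchurExpansion F A) (hB : IsSchurExpansion F B) : A = B := by
  funext lam
  have key : ∀ A, IsSchurExpansion F A → (kostka K lam.card).mulVec (fun lam => A lam.1) =
      fun μ => MvPowerSeries.coeff (rowExp μ.1) F := by
    intro A hA
    funext μ
    rw [kostka_mulVec, hA, finsum_mul_coeff_schur, degree_rowExp, mem_diagrams.1 μ.2]
  have h := (key A hA).trans (key B hB).symm
  have h2 := congrArg (kostka K lam.card)⁻¹.mulVec h
  rw [Matrix.mulVec_mulVec, Matrix.mulVec_mulVec,
    Matrix.nonsing_inv_mul _ (isUnit_det_kostka _), Matrix.one_mulVec, Matrix.one_mulVec] at h2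
  exact congrFun h2 ⟨lam, mem_diagrams.2 rfl⟩

theorem schurCoeff_eq {F : MvPowerSeries ℕ K} {A : YoungDiagram → K} (h : IsSchurExpansion F A) :
    schurCoeff F = A := by
  have hex : ∃ A, IsSchurExpansion F A := ⟨A, h⟩
  rw [schurCoeff, dif_pos hex]
  exact isSchurExpansion_unique hex.choose_spec h

theorem isSchurExpansion_schurCoeff {F : MvPowerSeries ℕ K} (hF : F ∈ SymSeries K) :
    IsSchurExpansion F (schurCoeff F) := by
  obtain ⟨A, hA⟩ := exists_isSchurExpansion hF
  rwa [schurCoeff_eq hA]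

/-- The Schur functions of degree exceeding that of `F` do not occur in the expansion of `F`. -/
theorem schurCoeff_eq_zero {F : MvPowerSeries ℕ K} (hF : F ∈ SymSeries K) {N : ℕ}
    (hN : ∀ d : ℕ →₀ ℕ, N < d.degree → MvPowerSeries.coeff d F = 0) {lam : YoungDiagram}
    (h : N < lam.card) : schurCoeff F lam = 0 := by
  -- Dropping the coefficients in degrees above N still gives an expansion of F, as Schur functions
  -- are homogeneous; uniqueness concludes.
  have hA : IsSchurExpansion F fun lam => if N < lam.card then 0 else schurCoeff F lam := by
    intro d
    rw [finsum_mul_coeff_schur]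
    by_cases hd : N < d.degree
    · rw [hN d hd]
      refine (Finset.sum_eq_zero fun lam hlam => ?_).symm
      rw [if_pos (by rwa [mem_diagrams.1 hlam]), zero_mul]
    · rw [isSchurExpansion_schurCoeff hF d, finsum_mul_coeff_schur]
      refine Finset.sum_congr rfl fun lam hlam => ?_
      rw [if_neg (by rwa [mem_diagrams.1 hlam])]
  rw [schurCoeff_eq hA]
  exact if_pos h

/-! ### One-column diagrams and `E t` -/

theorem card_oneColumn (n : ℕ) : (oneColumn n).card = n := by
  simp [YoungDiagram.card, oneColumn]

theorem mem_oneColumn {n : ℕ} {c : ℕ × ℕ} : c ∈ oneColumn n ↔ c.1 < n ∧ c.2 = 0 := by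
  rw [← YoungDiagram.mem_cells, oneColumn, Finset.mem_product, Finset.mem_range,
    Finset.mem_singleton]

theorem eq_oneColumn {lam : YoungDiagram} (h : lam.rowLen 0 ≤ 1) : lam = oneColumn lam.card := by
  have key : lam = oneColumn (lam.colLen 0) := by
    ext ⟨i, j⟩
    rw [YoungDiagram.mem_cells, YoungDiagram.mem_cells, mem_oneColumn]
    constructor
    · intro hc
      have h1 := YoungDiagram.mem_iff_lt_rowLen.1 hc
      have h2 := lam.rowLen_anti 0 i (Nat.zero_le i)
      obtain rfl : j = 0 := by omega
      exact ⟨YoungDiagram.mem_iff_lt_colLen.1 hc, rfl⟩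
    · rintro ⟨h1, rfl⟩
      exact YoungDiagram.mem_iff_lt_colLen.2 h1
  have hc : lam.card = lam.colLen 0 := by
    conv_lhs => rw [key]
    exact card_oneColumn _
  rw [hc]
  exact key

theorem rowLen_oneColumn (n i : ℕ) : (oneColumn n).rowLen i = if i < n then 1 else 0 := by
  have key : ∀ j, j < (oneColumn n).rowLen i ↔ i < n ∧ j = 0 := fun j => by
    rw [← YoungDiagram.mem_iff_lt_rowLen, mem_oneColumn]
  have h0 := key 0
  have h1 := key 1
  by_cases h : i < n
  · rw [if_pos h]
    have := h0.2 ⟨h, rfl⟩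
    have : ¬ 1 < (oneColumn n).rowLen i := fun h' => absurd (h1.1 h').2 one_ne_zero
    omega
  · rw [if_neg h]
    have : ¬ 0 < (oneColumn n).rowLen i := fun h' => h (h0.1 h').1
    omega

theorem rowLen_oneColumn_le (n i : ℕ) : (oneColumn n).rowLen i ≤ 1 := by
  rw [rowLen_oneColumn]
  split_ifs <;> omega

theorem coeff_elemGen (t : K) (d : ℕ →₀ ℕ) [Decidable (∀ k, d k ≤ 1)] :
    MvPowerSeries.coeff d (elemGen t) = if ∀ k, d k ≤ 1 then t ^ d.degree else 0 := by
  classical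
  change ∑ᶠ i : ℕ, t ^ i * MvPowerSeries.coeff d (elem K i) = _
  have h : ∀ i, MvPowerSeries.coeff d (elem K i) =
      if (∀ k, d k ≤ 1) ∧ d.degree = i then (1 : K) else 0 := by
    intro i
    change elem K i d = _
    rw [elem]
    congr
  simp only [h]
  rw [finsum_eq_single _ d.degree]
  · simp
  · intro i hi
    rw [if_neg fun h' => hi h'.2.symm, mul_zero]

/-- On monomials with decreasing exponents both sides live on one-column shapes: by dominance, x^μ
occurs in the Schur function of a column only if μ is a column. -/
theorem schurCoeff_elemGen (t : K) (lam : YoungDiagram) :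
    schurCoeff (elemGen t) lam = if lam.rowLen 0 ≤ 1 then t ^ lam.card else 0 := by
  classical
  have hA : IsSchurExpansion (elemGen t)
      fun lam => if lam.rowLen 0 ≤ 1 then t ^ lam.card else 0 := by
    refine (isSchurExpansion_iff (elemGen_mem t)).2 fun μ => ?_
    have hiff : (∀ k, rowExp μ k ≤ 1) ↔ μ.rowLen 0 ≤ 1 :=
      ⟨fun h => h 0, fun h k => (μ.rowLen_anti 0 k (Nat.zero_le k)).trans h⟩
    rw [coeff_elemGen, degree_rowExp, if_congr hiff rfl rfl,
      Finset.sum_eq_single_of_mem (oneColumn μ.card) (mem_diagrams.2 (card_oneColumn _))]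
    · rw [if_pos (rowLen_oneColumn_le _ _), card_oneColumn]
      split_ifs with h
      · rw [← eq_oneColumn h, coeff_rowExp_schur_self, mul_one]
      · have : MvPowerSeries.coeff (rowExp μ) (schur K (oneColumn μ.card)) = 0 := by
          by_contra hne
          have := dominance_of_coeff_ne_zero hne 1
          simp only [Finset.sum_range_one] at this
          exact h (this.trans (rowLen_oneColumn_le _ _))
        rw [this, mul_zero]
    · intro lam hlam hne
      rw [if_neg, zero_mul]
      intro h
      have := eq_oneColumn h
      rw [mem_diagrams.1 hlam] at this
      exact hne this
  rw [schurCoeff_eq hA]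

end SchurExpansion

/-! ### The pairing with `E t` -/

section Pairing

variable {K : Type*} [CommRing K]

open Classical in
/-- The operator whose row at the empty diagram lists the Schur coefficients of `E t`. -/
noncomputable def elemOp (t : K) : IA K :=
  ⟨fun μ lam => if μ ≤ lam ∧ lam.rowLen 0 ≤ 1 then t ^ lam.card else 0,
    fun _ _ h => if_neg fun h' => h h'.1⟩

theorem elemOp_bot (t : K) (lam : YoungDiagram) :
    elemOp t ⊥ lam = if lam.rowLen 0 ≤ 1 then t ^ lam.card else 0 := by
  simp [elemOp]

/-- This is the identity E(t)·∏ᵢ (1 + t xᵢ)⁻¹ = 1. If λ has l + 1 rows, then λ/(1^k) can be a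
horizontal strip only for k = l and k = l + 1, and the two terms cancel. -/
theorem elemOp_mul_horizOp (t : K) (lam : YoungDiagram) :
    (elemOp t * horizOp (-t)) ⊥ lam = if ⊥ = lam then 1 else 0 := by
  classical
  rw [IncidenceAlgebra.mul_apply]
  by_cases h0 : ⊥ = lam
  · subst h0
    simp [elemOp_bot, rowLen_bot, horizOp, transfer, skewCells_self, interlacing_rowLen_self,
      YoungDiagram.card]
  rw [if_neg h0]
  have hpos : 0 < lam.colLen 0 := by
    by_contra hc
    refine h0 (le_antisymm bot_le ?_)
    rw [le_iff_colLen]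
    intro i
    have := lam.colLen_anti 0 i (Nat.zero_le i)
    omega
  obtain ⟨l, hl⟩ := Nat.exists_eq_add_one_of_ne_zero hpos.ne'
  have hrow : ∀ i, 0 < lam.rowLen i ↔ i < l + 1 := fun i => by
    rw [← YoungDiagram.mem_iff_lt_rowLen, YoungDiagram.mem_iff_lt_colLen, hl]
  have hle : ∀ k, oneColumn k ≤ lam ↔ k ≤ l + 1 := by
    intro k
    constructor
    · intro h
      rcases k with _ | k
      · omega
      · exact (hrow k).1 (YoungDiagram.mem_iff_lt_rowLen.1 (h (mem_oneColumn.2 ⟨by simp, rfl⟩)))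
    · rintro hk ⟨i, j⟩ hc
      obtain ⟨h1, h2⟩ := mem_oneColumn.1 hc
      dsimp only at h1 h2
      subst h2
      exact YoungDiagram.mem_iff_lt_rowLen.2 ((hrow i).2 (by omega))
  have hne : oneColumn l ≠ oneColumn (l + 1) := fun h => by
    have := congrArg YoungDiagram.card h
    rw [card_oneColumn, card_oneColumn] at this
    omega
  -- The two conditions differ only at i = l, where they bound row l + 1 of λ, which is empty.
  have hint : Interlacing YoungDiagram.rowLen (oneColumn l) lam ↔
      Interlacing YoungDiagram.rowLen (oneColumn (l + 1)) lam := by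
    refine forall_congr' fun i => ?_
    rw [rowLen_oneColumn, rowLen_oneColumn]
    by_cases hi : i = l
    · have := hrow (i + 1)
      split_ifs <;> omega
    · split_ifs <;> omega
  have hcard : l + 1 ≤ lam.card := by
    have := Finset.card_le_card (YoungDiagram.cells_subset_iff.2 ((hle (l + 1)).2 le_rfl))
    rwa [← YoungDiagram.card, card_oneColumn] at this
  rw [← Finset.sum_subset (s₁ := {oneColumn l, oneColumn (l + 1)}), Finset.sum_pair hne,
    elemOp_bot, elemOp_bot, if_pos (rowLen_oneColumn_le _ _), if_pos (rowLen_oneColumn_le _ _),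
    card_oneColumn, card_oneColumn, horizOp]
  · by_cases h : Interlacing YoungDiagram.rowLen (oneColumn (l + 1)) lam
    · rw [transfer_apply _ ((hle _).2 (Nat.le_succ l)) (hint.2 h), transfer_apply _ ((hle _).2 le_rfl) h,
        card_skewCells ((hle _).2 (Nat.le_succ l)), card_skewCells ((hle _).2 le_rfl),
        card_oneColumn, card_oneColumn,
        show lam.card - l = lam.card - (l + 1) + 1 by omega]
      ring
    · rw [transfer_apply_of_not _ h, transfer_apply_of_not _ (fun h' => h (hint.1 h')), mul_zero,
        mul_zero, add_zero]
  · intro ν hν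
    rw [Finset.mem_Icc]
    refine ⟨bot_le, ?_⟩
    rw [Finset.mem_insert, Finset.mem_singleton] at hν
    rcases hν with rfl | rfl
    · exact (hle _).2 (Nat.le_succ l)
    · exact (hle _).2 le_rfl
  · intro ν hν hν'
    rw [Finset.mem_Icc] at hν
    rw [elemOp_bot]
    split_ifs with h1
    swap
    · rw [zero_mul]
    rw [horizOp, transfer_apply_of_not, mul_zero]
    intro hi
    have heq := eq_oneColumn h1
    generalize ν.card = k at heq
    subst heq
    have h2 := (hle k).1 hν.2
    have h3 := hi k
    rw [rowLen_oneColumn, if_neg (lt_irrefl k)] at h3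
    have h4 := hrow (k + 1)
    rw [Finset.mem_insert, Finset.mem_singleton, not_or] at hν'
    have h5 : k ≠ l := fun h => hν'.1 (by rw [h])
    have h6 : k ≠ l + 1 := fun h => hν'.2 (by rw [h])
    omega

/-- The polynomial `p` arises from `f` by setting to zero all variables except the first `N`. -/
def IsTrunc (N : ℕ) (f : MvPowerSeries ℕ K) (p : MvPolynomial ℕ K) : Prop :=
  ∀ d : ℕ →₀ ℕ, ((∀ k, N ≤ k → d k = 0) → MvPolynomial.coeff d p = MvPowerSeries.coeff d f) ∧
    ∀ k, N ≤ k → d k ≠ 0 → MvPolynomial.coeff d p = 0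

/-! ### Truncation to finitely many variables and values at equal variables -/

theorem IsTrunc.unique {N : ℕ} {f : MvPowerSeries ℕ K} {p q : MvPolynomial ℕ K}
    (hp : IsTrunc N f p) (hq : IsTrunc N f q) : p = q := by
  ext d
  by_cases hd : ∀ k, N ≤ k → d k = 0
  · rw [(hp d).1 hd, (hq d).1 hd]
  · push Not at hd
    obtain ⟨k, hk, hdk⟩ := hd
    rw [(hp d).2 k hk hdk, (hq d).2 k hk hdk]

theorem IsTrunc.add {N : ℕ} {f g : MvPowerSeries ℕ K} {p q : MvPolynomial ℕ K}
    (hp : IsTrunc N f p) (hq : IsTrunc N g q) : IsTrunc N (f + g) (p + q) := by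
  refine fun d => ⟨fun hd => ?_, fun k hk hdk => ?_⟩
  · rw [MvPolynomial.coeff_add, map_add, (hp d).1 hd, (hq d).1 hd]
  · rw [MvPolynomial.coeff_add, (hp d).2 k hk hdk, (hq d).2 k hk hdk, add_zero]

theorem IsTrunc.mul {N : ℕ} {f g : MvPowerSeries ℕ K} {p q : MvPolynomial ℕ K}
    (hp : IsTrunc N f p) (hq : IsTrunc N g q) : IsTrunc N (f * g) (p * q) := by
  classical
  refine fun d => ⟨fun hd => ?_, fun k hk hdk => ?_⟩
  · rw [MvPolynomial.coeff_mul, MvPowerSeries.coeff_mul]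
    refine Finset.sum_congr rfl fun x hx => ?_
    rw [Finset.HasAntidiagonal.mem_antidiagonal] at hx
    have hx' : ∀ k, N ≤ k → x.1 k + x.2 k = 0 := fun k hk => by
      rw [← Finsupp.add_apply, hx, hd k hk]
    rw [(hp x.1).1 fun k hk => (add_eq_zero.1 (hx' k hk)).1,
      (hq x.2).1 fun k hk => (add_eq_zero.1 (hx' k hk)).2]
  · rw [MvPolynomial.coeff_mul]
    refine Finset.sum_eq_zero fun x hx => ?_
    rw [Finset.HasAntidiagonal.mem_antidiagonal] at hx
    have hx' : x.1 k + x.2 k ≠ 0 := by rwa [← Finsupp.add_apply, hx]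
    by_cases h : x.1 k = 0
    · rw [(hq x.2).2 k hk fun h' => hx' (by rw [h, h']), mul_zero]
    · rw [(hp x.1).2 k hk h, zero_mul]

theorem isTrunc_C (N : ℕ) (c : K) : IsTrunc N (algebraMap K (MvPowerSeries ℕ K) c)
    (MvPolynomial.C c) := by
  classical
  refine fun d => ⟨fun _ => ?_, fun k _ hdk => ?_⟩
  · rw [← MvPowerSeries.c_eq_algebraMap, MvPowerSeries.coeff_C, MvPolynomial.coeff_C]
    exact if_congr eq_comm rfl rfl
  · rw [MvPolynomial.coeff_C, if_neg]
    rintro rfl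
    exact hdk rfl

/-- The value of `f` at `n` variables equal to `-t` depends polynomially on `n`, and `Q` is this
polynomial function, shifted by one: `Q 0` is its value at `n = -1`. -/
def HasValues (t : K) (f : MvPowerSeries ℕ K) (Q : ℕ → K) : Prop :=
  Q ∈ polySeq K ∧ ∀ n, ∃ p, IsTrunc n f p ∧ MvPolynomial.eval (fun _ => -t) p = Q (n + 1)

variable {t : K} {f g : MvPowerSeries ℕ K} {Q Q' : ℕ → K}

/-- The truncations determine Q at all positive arguments, and vanishing differences then determine
Q 0. -/
theorem HasValues.unique (h : HasValues t f Q) (h' : HasValues t f Q') : Q = Q' := by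
  refine polySeq_ext h.1 h'.1 fun n => ?_
  obtain ⟨p, hp, hpQ⟩ := h.2 n
  obtain ⟨q, hq, hqQ⟩ := h'.2 n
  rw [← hpQ, ← hqQ, hp.unique hq]

theorem HasValues.add (h : HasValues t f Q) (h' : HasValues t g Q') :
    HasValues t (f + g) (Q + Q') := by
  refine ⟨add_mem h.1 h'.1, fun n => ?_⟩
  obtain ⟨p, hp, hpQ⟩ := h.2 n
  obtain ⟨q, hq, hqQ⟩ := h'.2 n
  exact ⟨p + q, hp.add hq, by rw [map_add, hpQ, hqQ]; rfl⟩

theorem HasValues.mul (h : HasValues t f Q) (h' : HasValues t g Q') :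
    HasValues t (f * g) (Q * Q') := by
  refine ⟨mul_mem h.1 h'.1, fun n => ?_⟩
  obtain ⟨p, hp, hpQ⟩ := h.2 n
  obtain ⟨q, hq, hqQ⟩ := h'.2 n
  exact ⟨p * q, hp.mul hq, by rw [map_mul, hpQ, hqQ]; rfl⟩

theorem hasValues_algebraMap (t c : K) :
    HasValues t (algebraMap K (MvPowerSeries ℕ K) c) (algebraMap K (ℕ → K) c) :=
  ⟨Subalgebra.algebraMap_mem _ c, fun n => ⟨_, isTrunc_C n c, by simp⟩⟩

theorem HasValues.sum {ι : Type*} (s : Finset ι) {f : ι → MvPowerSeries ℕ K} {Q : ι → ℕ → K}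
    (h : ∀ i ∈ s, HasValues t (f i) (Q i)) : HasValues t (∑ i ∈ s, f i) (∑ i ∈ s, Q i) := by
  classical
  induction s using Finset.induction_on with
  | empty => simpa using hasValues_algebraMap t 0
  | insert a s ha ih =>
    rw [Finset.sum_insert ha, Finset.sum_insert ha]
    exact (h a (Finset.mem_insert_self a s)).add (ih fun i hi => h i (Finset.mem_insert_of_mem hi))

theorem IsChainSeries.exists_isTrunc {P : YoungDiagram → YoungDiagram → Prop}
    {e : YoungDiagram → YoungDiagram → ℕ} {μ lam : YoungDiagram} (hF : IsChainSeries P e μ lam f)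
    (hP : ∀ μ, P μ μ) (he : ∀ μ lam, μ ≤ lam → (e μ lam = 0 ↔ μ = lam)) (hle : μ ≤ lam) (t : K)
    (n : ℕ) : ∃ p, IsTrunc n f p ∧
      MvPolynomial.eval (fun _ => -t) p = (transfer P e (-t) ^ n) μ lam := by
  refine ⟨prodTransfer K P e (List.range n) μ lam, fun d => ⟨fun hd => hF.coeff_prod hP he hle hd,
    fun k hk hdk => coeff_prodTransfer_eq_zero hP he hle hk hdk⟩, ?_⟩
  change iaMap (MvPolynomial.eval fun _ => -t) _ μ lam = _
  rw [iaMap_prodTransfer]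
  simp

/-- Row ∅ of `elemOp t * horizOp (-t)` is that of the identity, so at n + 1 the entry is that of
`horizOp (-t) ^ n`. At 0 it is the coefficient of the Schur function in E(t). -/
theorem hasValues_schur (t : K) (lam : YoungDiagram) :
    HasValues t (schur K lam) fun n => (elemOp t * horizOp (-t) ^ n) ⊥ lam := by
  have he : ∀ μ lam : YoungDiagram, μ ≤ lam → ((skewCells lam μ).card = 0 ↔ μ = lam) :=
    fun _ _ h => card_skewCells_eq_zero_iff h
  refine ⟨ia_mul_pow_mem_polySeq (transfer_self interlacing_rowLen_self he _) _ _ _, fun n => ?_⟩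
  obtain ⟨p, hp, hpv⟩ :=
    (isChainSeries_schur K lam).exists_isTrunc interlacing_rowLen_self he bot_le t n
  refine ⟨p, hp, hpv.trans ?_⟩
  dsimp only
  rw [pow_succ', ← mul_assoc, IncidenceAlgebra.mul_apply,
    Finset.sum_eq_single_of_mem ⊥ (by simp)]
  · rw [elemOp_mul_horizOp, if_pos rfl, one_mul]
    rfl
  · intro x _ hx
    rw [elemOp_mul_horizOp, if_neg (Ne.symm hx), zero_mul]

/-- Here `vertOp t` is an inverse of `colOp (-t)` in all rows, so skew shapes are covered, and the
value at 0 is an entry of `vertOp t`. -/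
theorem hasValues_dualGroth (t : K) {μ lam : YoungDiagram} (hle : μ ≤ lam) :
    HasValues t (dualGroth K lam μ) fun n => (vertOp t * colOp (-t) ^ n) μ lam := by
  refine ⟨ia_mul_pow_mem_polySeq (colOp_self _) _ _ _, fun n => ?_⟩
  obtain ⟨p, hp, hpv⟩ := (isChainSeries_dualGroth K lam μ).exists_isTrunc (fun _ => trivial)
    (fun _ _ h => numCols_eq_zero_iff h) hle t n
  refine ⟨p, hp, hpv.trans ?_⟩
  dsimp only
  rw [pow_succ', ← mul_assoc, vertOp_mul_colOp, one_mul]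
  rfl

/-- By linearity this reduces to Schur functions, for which the value at 0 is the corresponding
coefficient of E(t). -/
theorem exists_hasValues (t : K) (f : SymFun K) :
    ∃ Q, HasValues t (f : MvPowerSeries ℕ K) Q ∧ Q 0 = hall (E t) f := by
  classical
  obtain ⟨f, hf, D, hD⟩ := f
  -- Bounded degree confines the Schur expansion of f to the finitely many diagrams with at most D
  -- boxes.
  set s := (range (D + 1)).biUnion diagrams
  have hs : ∀ lam, schurCoeff f lam ≠ 0 → lam ∈ s := by
    intro lam h
    rw [Finset.mem_biUnion]
    refine ⟨lam.card, Finset.mem_range.2 ?_, mem_diagrams.2 rfl⟩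
    by_contra hlt
    exact h (schurCoeff_eq_zero hf hD (by omega))
  have hsum : f = ∑ lam ∈ s, algebraMap K (MvPowerSeries ℕ K) (schurCoeff f lam) * schur K lam := by
    ext d
    rw [isSchurExpansion_schurCoeff hf d, finsum_eq_sum_of_support_subset (s := s), map_sum]
    · refine Finset.sum_congr rfl fun lam _ => ?_
      rw [← MvPowerSeries.c_eq_algebraMap, MvPowerSeries.coeff_C_mul]
    · exact fun lam h => hs lam (left_ne_zero_of_mul h)
  refine ⟨∑ lam ∈ s, algebraMap K (ℕ → K) (schurCoeff f lam) *
    fun n => (elemOp t * horizOp (-t) ^ n) ⊥ lam, ?_, ?_⟩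
  · dsimp only
    conv => enter [2]; rw [hsum]
    exact HasValues.sum s fun lam _ => (hasValues_algebraMap t _).mul (hasValues_schur t lam)
  · rw [hall, finsum_eq_sum_of_support_subset (s := s), Finset.sum_apply]
    · refine Finset.sum_congr rfl fun lam _ => ?_
      change schurCoeff f lam * (elemOp t * horizOp (-t) ^ 0) ⊥ lam =
        schurCoeff (elemGen t) lam * schurCoeff f lam
      rw [pow_zero, mul_one, elemOp_bot, schurCoeff_elemGen, mul_comm]
    · exact fun lam h => hs lam (right_ne_zero_of_mul h)

theorem HasValues.hall_eq {f : SymFun K} (h : HasValues t (f : MvPowerSeries ℕ K) Q) :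
    hall (E t) f = Q 0 := by
  obtain ⟨Q', h', h0⟩ := exists_hasValues t f
  rw [← h0, h.unique h']

theorem hasValues_hall (t : K) (f : SymFun K) :
    ∃ Q, HasValues t (f : MvPowerSeries ℕ K) Q := (exists_hasValues t f).imp fun _ h => h.1

/-- The pairing with `E t` as an algebra homomorphism. -/
noncomputable def hallHom (t : K) : SymFun K →ₐ[K] K where
  toFun f := hall (E t) f
  map_one' := by
    have h : HasValues t ((1 : SymFun K) : MvPowerSeries ℕ K) (algebraMap K (ℕ → K) 1) := by
      simpa using hasValues_algebraMap t 1
    rw [h.hall_eq]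
    simp
  map_mul' f g := by
    obtain ⟨Q, hQ⟩ := hasValues_hall t f
    obtain ⟨R, hR⟩ := hasValues_hall t g
    have h : HasValues t ((f * g : SymFun K) : MvPowerSeries ℕ K) (Q * R) := hQ.mul hR
    rw [h.hall_eq, hQ.hall_eq, hR.hall_eq, Pi.mul_apply]
  map_zero' := by
    have h : HasValues t ((0 : SymFun K) : MvPowerSeries ℕ K) (algebraMap K (ℕ → K) 0) := by
      simpa using hasValues_algebraMap t 0
    rw [h.hall_eq]
    simp
  map_add' f g := by
    obtain ⟨Q, hQ⟩ := hasValues_hall t f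
    obtain ⟨R, hR⟩ := hasValues_hall t g
    have h : HasValues t ((f + g : SymFun K) : MvPowerSeries ℕ K) (Q + R) := hQ.add hR
    rw [h.hall_eq, hQ.hall_eq, hR.hall_eq, Pi.add_apply]
  commutes' c := by
    have h : HasValues t ((algebraMap K (SymFun K) c : SymFun K) : MvPowerSeries ℕ K)
      (algebraMap K (ℕ → K) c) := hasValues_algebraMap t c
    rw [h.hall_eq]
    rfl

theorem hall_dualGroth (t : K) {μ lam : YoungDiagram} (hle : μ ≤ lam)
    (hg : dualGroth K lam μ ∈ SymFun K) :
    hall (E t) ⟨dualGroth K lam μ, hg⟩ = if IsVerticalStrip lam μ then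
      t ^ numCols lam μ * (t + 1) ^ ((skewCells lam μ).card - numCols lam μ) else 0 := by
  rw [HasValues.hall_eq (f := ⟨dualGroth K lam μ, hg⟩) (hasValues_dualGroth t hle), pow_zero,
    mul_one, vertOp_apply t hle]

theorem isVerticalStrip_bot_iff {lam : YoungDiagram} :
    IsVerticalStrip lam ⊥ ↔ lam.rowLen 0 ≤ 1 := by
  constructor
  · intro h
    by_contra! hlt
    have := h (0, 0) (mem_skewCells_bot.2 (YoungDiagram.mem_iff_lt_rowLen.2 (by omega)))
      (0, 1) (mem_skewCells_bot.2 (YoungDiagram.mem_iff_lt_rowLen.2 hlt)) rfl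
    simp at this
  · rintro h ⟨i, j⟩ ha ⟨i', j'⟩ hb hi
    have h1 := YoungDiagram.mem_iff_lt_rowLen.1 (mem_skewCells_bot.1 ha)
    have h2 := YoungDiagram.mem_iff_lt_rowLen.1 (mem_skewCells_bot.1 hb)
    have h3 := lam.rowLen_anti 0 i (Nat.zero_le i)
    have h4 := lam.rowLen_anti 0 i' (Nat.zero_le i')
    obtain rfl : i = i' := hi
    rw [Prod.mk.injEq]
    omega

theorem numCols_oneColumn {n : ℕ} (hn : 1 ≤ n) : numCols (oneColumn n) ⊥ = 1 := by
  rw [numCols, skewCells_bot, Finset.card_eq_one]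
  refine ⟨0, ?_⟩
  ext j
  simp only [Finset.mem_image, YoungDiagram.mem_cells, mem_oneColumn, Finset.mem_singleton]
  constructor
  · rintro ⟨c, h, rfl⟩
    exact h.2
  · rintro rfl
    exact ⟨(0, 0), ⟨by dsimp only; omega, rfl⟩, rfl⟩

end Pairing

end DualGrothendieck

/-! ### The main theorem -/

theorem mainTheorem6 {K : Type*} [CommRing K] (t : K) :
    -- every skew function belongs to the ring of symmetric functions
    ∃ hg : ∀ lam μ : YoungDiagram, μ ≤ lam →
        DualGrothendieck.dualGroth K lam μ ∈ DualGrothendieck.SymFun K,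
      -- the pairing with `E(t)` is a ring homomorphism
      (∃ φ : DualGrothendieck.SymFun K →ₐ[K] K,
        ∀ f, φ f = DualGrothendieck.hall (DualGrothendieck.E t) f) ∧
      -- its value on skew shapes
      (∀ (lam μ : YoungDiagram) (h : μ ≤ lam),
        DualGrothendieck.hall (DualGrothendieck.E t)
            ⟨DualGrothendieck.dualGroth K lam μ, hg lam μ h⟩ =
          if DualGrothendieck.IsVerticalStrip lam μ then
            t ^ DualGrothendieck.numCols lam μ *
              (t + 1) ^ ((DualGrothendieck.skewCells lam μ).card -
                DualGrothendieck.numCols lam μ)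
          else 0) ∧
      -- its value on straight shapes
      (DualGrothendieck.hall (DualGrothendieck.E t)
          ⟨DualGrothendieck.dualGroth K ⊥ ⊥, hg ⊥ ⊥ bot_le⟩ = 1) ∧
      (∀ n : ℕ, 1 ≤ n →
        DualGrothendieck.hall (DualGrothendieck.E t)
            ⟨DualGrothendieck.dualGroth K (DualGrothendieck.oneColumn n) ⊥,
              hg (DualGrothendieck.oneColumn n) ⊥ bot_le⟩ =
          t * (t + 1) ^ (n - 1)) ∧
      (∀ lam : YoungDiagram, lam ≠ ⊥ → (∀ n : ℕ, 1 ≤ n → lam ≠ DualGrothendieck.oneColumn n) →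
        DualGrothendieck.hall (DualGrothendieck.E t)
            ⟨DualGrothendieck.dualGroth K lam ⊥, hg lam ⊥ bot_le⟩ = 0) := by
  refine ⟨fun lam μ h => DualGrothendieck.dualGroth_mem K h,
    ⟨DualGrothendieck.hallHom t, fun _ => rfl⟩, fun lam μ h => DualGrothendieck.hall_dualGroth t h _,
    ?_, fun n hn => ?_, fun lam h0 h1 => ?_⟩
  · rw [DualGrothendieck.hall_dualGroth t bot_le, if_pos]
    · simp [DualGrothendieck.numCols, DualGrothendieck.skewCells_self]
    · simp [DualGrothendieck.IsVerticalStrip, DualGrothendieck.skewCells_self]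
  · rw [DualGrothendieck.hall_dualGroth t bot_le, if_pos
      (DualGrothendieck.isVerticalStrip_bot_iff.2 (DualGrothendieck.rowLen_oneColumn_le n 0)),
      DualGrothendieck.numCols_oneColumn hn, DualGrothendieck.skewCells_bot, pow_one]
    congr 3
    exact DualGrothendieck.card_oneColumn n
  · rw [DualGrothendieck.hall_dualGroth t bot_le, if_neg]
    rw [DualGrothendieck.isVerticalStrip_bot_iff]
    intro h
    refine h1 lam.card ?_ (DualGrothendieck.eq_oneColumn h)
    by_contra hc
    refine h0 (YoungDiagram.ext ?_)
    rw [YoungDiagram.cells_bot, ← Finset.card_eq_zero]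
    simp only [YoungDiagram.card] at hc
    omega
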